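/- **Theorem 3.1.** A partition is a weakly decreasing sequence $\lambda=(\lambda_1,\lambda_2,\ldots)$ of non-negative integers with finitely many non-zero terms (zero parts are immaterial); it is identified with its diagram, which has $\lambda_i$ left-justified boxes in row $i$. For a partition $\lambda$ and an integer $n\ge 0$ let $\lambda+(1^n)=(\lambda_1+1,\ldots,\lambda_n+1,\lambda_{n+1},\ldots)$, and let $\lambda\cup(n)$ be the partition obtained from $\lambda$ by inserting one additional part $n$, so that $\lambda\cup(n)=(\lambda_1,\ldots,\lambda_i,n,\lambda_{i+1},\ldots)$ where $\lambda_i\ge n\ge\lambda_{i+1}$. For partitions $\lambda,\mu,\nu$ let $c(\lambda;\mu,\nu)$ be the Littlewood–Richardson coefficient: if $\mu\subseteq\lambda$ as diagrams, it is the number of fillings $T$ of the boxes of $\lambda/\mu$ with positive integers such that - $T(i,j)\le T(i,j+1)$ and $T(i,j)<T(i+1,j)$ whenever both sides are defined; - each $k\ge 1$ occurs exactly $\nu_k$ times in $T$; - in every initial segment of the word obtained by reading the entries of $T$ from right to left in each row, the rows being read from top to bottom, each $k\ge1$ occurs at least as often as $k+1$. If $\mu\not\subseteq\lambda$, then $c(\lambda;\mu,\nu)=0$.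 Let $\lambda,\mu,\nu$ be partitions and let $a\ge b\ge 0$ be integers. Then \[c(\lambda;\mu,\nu)\le c\bigl(\lambda+(1^a);\,\mu+(1^b),\,\nu+(1^{a-b})\bigr)\] and \[c(\lambda;\mu,\nu)\le c\bigl(\lambda\cup(a);\,\mu\cup(b),\,\nu\cup(a-b)\bigr).\] -/

import Mathlib

namespace YoungDiagram

/-!
Partitions are Mathlib's Young diagrams: `lam.rowLen i` is the `(i+1)`-st part of `lam`
(it is `0` beyond the last row), and trailing zero parts are immaterial.
Rows and columns are numbered from `0`.
-/

/-- The partition `lam + (1^n)`: every one of the first `n` parts of `lam` (zero parts included)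
is increased by one. -/
def addColumn (lam : YoungDiagram) (n : ℕ) : YoungDiagram where
  cells := (Finset.range (lam.colLen 0 + n) ×ˢ Finset.range (lam.rowLen 0 + 1)).filter
    (fun c => c.2 < lam.rowLen c.1 + if c.1 < n then 1 else 0)
  isLowerSet := by
    rintro ⟨i, j⟩ ⟨i', j'⟩ ⟨hi, hj⟩ h
    simp only [Finset.coe_filter, Finset.mem_product, Finset.mem_range, Set.mem_ofPred_eq] at h ⊢
    have hr := lam.rowLen_anti i' i hi
    dsimp only at hi hj
    refine ⟨⟨by omega, by omega⟩, ?_⟩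
    have h2 := h.2
    split_ifs at h2 ⊢ <;> omega

/-- The defining property of `lam + (1^n)`. -/
theorem rowLen_addColumn (lam : YoungDiagram) (n i : ℕ) :
    (lam.addColumn n).rowLen i = lam.rowLen i + if i < n then 1 else 0 := by
  have key : ∀ j, j < (lam.addColumn n).rowLen i ↔ j < lam.rowLen i + if i < n then 1 else 0 := by
    intro j
    rw [← mem_iff_lt_rowLen, ← mem_cells]
    simp only [addColumn, Finset.mem_filter, Finset.mem_product, Finset.mem_range]
    refine ⟨fun h => h.2, fun h => ⟨⟨?_, ?_⟩, h⟩⟩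
    · by_cases hn : i < n
      · omega
      · have : (i, 0) ∈ lam := mem_iff_lt_rowLen.2 (by simp only [hn, if_false] at h; omega)
        have := mem_iff_lt_colLen.1 this
        omega
    · have := lam.rowLen_anti 0 i (Nat.zero_le i)
      split_ifs at h <;> omega
  exact eq_of_forall_lt_iff key

/-- The partition `lam ∪ (n)`: the part `n` is inserted into the weakly decreasing sequence of
parts of `lam`, at the place where the sequence stays weakly decreasing. -/
def insertRow (lam : YoungDiagram) (n : ℕ) : YoungDiagram :=
  ofRowLens (lam.rowLens.orderedInsert (· ≥ ·) n)
    (List.Pairwise.sortedGE (lam.rowLens_sorted.pairwise.orderedInsert n))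

/-- The boxes of the skew diagram `lam / μ`. -/
def skewCells (lam μ : YoungDiagram) : Finset (ℕ × ℕ) :=
  lam.cells \ μ.cells

/-- The reverse row word of a filling `T` of `lam / μ`: the entries are read from right to left in
each row (row `i` of `lam / μ` has the columns `μ.rowLen i ≤ j < lam.rowLen i`), and the rows are
read from top to bottom. -/
def reverseRowWord (lam μ : YoungDiagram) (T : ℕ → ℕ → ℕ) : List ℕ :=
  (List.range (lam.colLen 0)).flatMap fun i =>
    (List.range' (μ.rowLen i) (lam.rowLen i - μ.rowLen i)).reverse.map (T i)

/-- A lattice word: in every initial segment, each `i ≥ 1` occurs at least as often as `i + 1`. -/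
def IsLatticeWord (w : List ℕ) : Prop :=
  ∀ n i : ℕ, 1 ≤ i → (w.take n).count (i + 1) ≤ (w.take n).count i

/-- `T` is a Littlewood-Richardson tableau of shape `lam / μ` and content `ν`. A tableau is
represented by a function `ℕ → ℕ → ℕ` that takes the value `0` outside the boxes of the shape. -/
structure IsLRTableau (lam μ ν : YoungDiagram) (T : ℕ → ℕ → ℕ) : Prop where
  le : μ ≤ lam
  zeros : ∀ i j, (i, j) ∉ skewCells lam μ → T i j = 0
  pos : ∀ i j, (i, j) ∈ skewCells lam μ → 1 ≤ T i j
  row_weak : ∀ i j, (i, j) ∈ skewCells lam μ → (i, j + 1) ∈ skewCells lam μ →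
    T i j ≤ T i (j + 1)
  col_strict : ∀ i j, (i, j) ∈ skewCells lam μ → (i + 1, j) ∈ skewCells lam μ →
    T i j < T (i + 1) j
  content : ∀ k, ((skewCells lam μ).filter fun c => T c.1 c.2 = k + 1).card = ν.rowLen k
  lattice : IsLatticeWord (reverseRowWord lam μ T)

/-- The Littlewood-Richardson coefficient `c(lam; μ, ν)`: the number of Littlewood-Richardson
tableaux of shape `lam / μ` and content `ν` (there are none unless `μ ⊆ lam`). -/
noncomputable def lrCoeff (lam μ ν : YoungDiagram) : ℕ :=
  Nat.card {T : ℕ → ℕ → ℕ // IsLRTableau lam μ ν T}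

/-- There are only finitely many tableaux to count, so `lrCoeff` is a genuine cardinality. -/
theorem finite_lrTableaux (lam μ ν : YoungDiagram) :
    Finite {T : ℕ → ℕ → ℕ // IsLRTableau lam μ ν T} := by
  have bound : ∀ T, IsLRTableau lam μ ν T → ∀ i j, T i j < ν.colLen 0 + 1 := by
    intro T hT i j
    by_cases hc : (i, j) ∈ skewCells lam μ
    · obtain ⟨k, hk⟩ : ∃ k, T i j = k + 1 := ⟨T i j - 1, by have := hT.pos i j hc; omega⟩
      have h1 : 0 < ν.rowLen k := by
        rw [← hT.content k, Finset.card_pos]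
        exact ⟨(i, j), Finset.mem_filter.2 ⟨hc, hk⟩⟩
      have h2 := mem_iff_lt_colLen.1 (mem_iff_lt_rowLen.2 h1)
      omega
    · rw [hT.zeros i j hc]
      omega
  refine Finite.of_injective (β := skewCells lam μ → Fin (ν.colLen 0 + 1))
    (fun T c => ⟨T.1 c.1.1 c.1.2, bound T.1 T.2 _ _⟩) ?_
  rintro ⟨T, hT⟩ ⟨S, hS⟩ h
  refine Subtype.ext (funext fun i => funext fun j => ?_)
  by_cases hc : (i, j) ∈ skewCells lam μ
  · simpa using congrArg Fin.val (congrFun h ⟨(i, j), hc⟩)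
  · exact (hT.zeros i j hc).trans (hS.zeros i j hc).symm

end YoungDiagram

/-! A Littlewood-Richardson tableau is encoded by two arrays of counts subject to linear equations
and inequalities (`hiveEquiv`), so such arrays can be added (`IsHive.add`). Adding the arrays of a
one-column tableau of shape (1^a)/(1^b) and content (1^(a-b)) (`isHive_column`) is injective and
gives the first inequality.

Inserting a part means adding a column to the conjugate diagram, so the second inequality is the
conjugate of the first, once the coefficients are known to be invariant under conjugating all three
partitions (`lrCoeff_transpose`). For this, fix μ and regard the coefficients as a matrix indexed by
ν and λ. A bijection of insertion type (`card_hives_pieri`) proves the Pieri rule: the matrix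
commutes with the transfer matrix of vertical strips. The inverse of that transfer matrix is the
signed matrix of horizontal strips, so the coefficient matrix commutes with horizontal strips too.
Conjugation exchanges the two kinds of strips, hence the conjugated coefficient matrix also commutes
with vertical strips. Among matrices of the right degree, one that commutes with vertical strips is
determined by its row at the empty diagram (`eq_zero_of_mul_verticalMatrix`), and there both
matrices have the entry 1 at λ = μ and 0 elsewhere. -/

namespace YoungDiagram

/-! ### Row lengths and arrays of counts. -/

theorem mem_skewCells {lam μ : YoungDiagram} {i j : ℕ} :
    (i, j) ∈ skewCells lam μ ↔ μ.rowLen i ≤ j ∧ j < lam.rowLen i := by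
  rw [skewCells, Finset.mem_sdiff, mem_cells, mem_cells, mem_iff_lt_rowLen, mem_iff_lt_rowLen]
  omega

theorem rowLen_eq_zero {lam : YoungDiagram} {i : ℕ} (h : lam.colLen 0 ≤ i) : lam.rowLen i = 0 := by
  by_contra h0
  have := mem_iff_lt_colLen.1 (mem_iff_lt_rowLen.2 (Nat.pos_of_ne_zero h0))
  omega

theorem ext_rowLen {lam μ : YoungDiagram} (h : ∀ i, lam.rowLen i = μ.rowLen i) : lam = μ := by
  ext ⟨i, j⟩
  rw [mem_cells, mem_cells, mem_iff_lt_rowLen, mem_iff_lt_rowLen, h]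

theorem le_iff_rowLen {lam μ : YoungDiagram} : μ ≤ lam ↔ ∀ i, μ.rowLen i ≤ lam.rowLen i := by
  constructor
  · intro h i
    by_contra hc
    have h1 : (i, lam.rowLen i) ∈ μ := mem_iff_lt_rowLen.2 (by omega)
    have := mem_iff_lt_rowLen.1 (h h1)
    omega
  · rintro h ⟨i, j⟩ hc
    exact mem_iff_lt_rowLen.2 ((mem_iff_lt_rowLen.1 hc).trans_le (h i))

/-- A Littlewood-Richardson tableau of shape `lam / μ` recorded by two arrays of counts: `N i k` is
the number of entries `k + 1` in the rows before row `i`, and `M i k` is the number of boxes of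
row `i` that belong to the inner shape or carry an entry at most `k`. -/
structure IsPrehive (lam μ : ℕ → ℕ) (N M : ℕ → ℕ → ℕ) : Prop where
  zero : ∀ k, N 0 k = 0
  mono : ∀ i k, N i k ≤ N (i + 1) k
  lat : ∀ i k, N (i + 1) (k + 1) ≤ N i k
  left : ∀ i, M i 0 = μ i
  rel : ∀ i k, M i (k + 1) + N i k = M i k + N (i + 1) k
  col : ∀ i k, M (i + 1) (k + 1) ≤ M i k
  right : ∀ i, M i (i + 1) = lam i

/-- The arrays of counts of a Littlewood-Richardson tableau of shape `lam / μ` and content `ν`. -/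
structure IsHive (lam μ ν : ℕ → ℕ) (N M : ℕ → ℕ → ℕ) : Prop extends IsPrehive lam μ N M where
  content : ∃ L, ∀ i, L ≤ i → ∀ k, N i k = ν k

namespace IsPrehive

variable {lam μ : ℕ → ℕ} {N M : ℕ → ℕ → ℕ}

/-- Following `lat` along the diagonal leads back to row `0`, where nothing has been counted. Hence
row `i` only has entries up to `i + 1`, which is why `right` is imposed at column `i + 1`. -/
theorem eq_zero_of_le (h : IsPrehive lam μ N M) : ∀ {i k : ℕ}, i ≤ k → N i k = 0
  | 0, k, _ => h.zero k
  | i + 1, k + 1, hk => by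
    have := h.lat i k
    rw [h.eq_zero_of_le (Nat.le_of_succ_le_succ hk)] at this
    omega

theorem row_mono (h : IsPrehive lam μ N M) (i : ℕ) : Monotone (M i) :=
  monotone_nat_of_le_succ fun k => by
    have := h.rel i k
    have := h.mono i k
    omega

theorem eq_right_of_le (h : IsPrehive lam μ N M) {i k : ℕ} (hk : i + 1 ≤ k) : M i k = lam i := by
  induction k, hk using Nat.le_induction with
  | base => exact h.right i
  | succ k hk ih =>
    have := h.rel i k
    rw [h.eq_zero_of_le (by omega : i ≤ k), h.eq_zero_of_le (by omega : i + 1 ≤ k)] at this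
    omega

theorem le_right (h : IsPrehive lam μ N M) (i k : ℕ) : M i k ≤ lam i := by
  rw [← h.eq_right_of_le (le_max_right k (i + 1))]
  exact h.row_mono i (le_max_left _ _)

theorem left_le (h : IsPrehive lam μ N M) (i k : ℕ) : μ i ≤ M i k := by
  rw [← h.left i]
  exact h.row_mono i (Nat.zero_le k)

theorem right_anti (h : IsPrehive lam μ N M) (i : ℕ) : lam (i + 1) ≤ lam i := by
  rw [← h.right i, ← h.right (i + 1)]
  exact h.col i (i + 1)

theorem letter_anti (h : IsPrehive lam μ N M) (i k : ℕ) : N i (k + 1) ≤ N i k :=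
  (h.mono i (k + 1)).trans (h.lat i k)

theorem eq_of_right_eq_zero (h : IsPrehive lam μ N M) {n : ℕ} (hn : ∀ i, n ≤ i → lam i = 0)
    {i : ℕ} (hi : n ≤ i) (k : ℕ) : N i k = N n k := by
  induction i, hi using Nat.le_induction with
  | base => rfl
  | succ i hi ih =>
    have := h.rel i k
    have := h.le_right i k
    have := h.le_right i (k + 1)
    have := hn i hi
    omega

end IsPrehive

theorem IsHive.eq_content {lam μ ν : ℕ → ℕ} {N M : ℕ → ℕ → ℕ} (h : IsHive lam μ ν N M) {n : ℕ}
    (hn : ∀ i, n ≤ i → lam i = 0) {i : ℕ} (hi : n ≤ i) (k : ℕ) : N i k = ν k := by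
  obtain ⟨L, hL⟩ := h.content
  rw [h.eq_of_right_eq_zero hn hi, ← h.eq_of_right_eq_zero hn (le_max_left n L),
    hL _ (le_max_right n L)]

/-! ### The lattice condition tested row by row. -/

theorem take_flatMap_range (f : ℕ → List ℕ) (L n : ℕ) :
    ∃ i m, i ≤ L ∧ ((List.range L).flatMap f).take n = (List.range i).flatMap f ++ (f i).take m ∧
      (i = L → m = 0) := by
  induction L with
  | zero => exact ⟨0, 0, le_rfl, by simp, by simp⟩
  | succ L ih =>
    obtain ⟨i, m, hi, h, h0⟩ := ih
    rw [List.range_succ, List.flatMap_append, List.take_append, h]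
    by_cases hn : n ≤ ((List.range L).flatMap f).length
    · refine ⟨i, m, by omega, ?_, by omega⟩
      rw [Nat.sub_eq_zero_of_le hn]
      simp
    · refine ⟨L, n - ((List.range L).flatMap f).length, by omega, ?_, by omega⟩
      rw [← h, List.take_of_length_le (by omega)]
      simp

/-- In a weakly decreasing block every `k + 2` is read before any `k + 1`. The critical prefix
therefore stops after the last `k + 2` of a block: it has seen the letters `k + 2` of this block but
only the letters `k + 1` of earlier blocks. -/
theorem isLatticeWord_flatMap_range {f : ℕ → List ℕ} (hf : ∀ i, (f i).Pairwise (· ≥ ·)) (L : ℕ) :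
    IsLatticeWord ((List.range L).flatMap f) ↔
      ∀ i < L, ∀ k, ((List.range (i + 1)).flatMap f).count (k + 2) ≤
        ((List.range i).flatMap f).count (k + 1) := by
  constructor
  · intro h i hi k
    -- A prefix of block `i` that contains all its letters `k + 2` and none of its letters `k + 1`.
    have hpre : ∃ m, (f i).count (k + 2) ≤ ((f i).take m).count (k + 2) ∧
        ((f i).take m).count (k + 1) = 0 := by
      have := hf i
      generalize f i = l at this
      induction l with
      | nil => exact ⟨0, by simp⟩
      | cons x l ih =>
        rw [List.pairwise_cons] at this
        by_cases hx : x ≤ k + 1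
        · refine ⟨0, ?_, by simp⟩
          rw [List.count_eq_zero_of_not_mem]
          · simp
          · rw [List.mem_cons]
            rintro (h | h)
            · omega
            · have := this.1 _ h
              omega
        · obtain ⟨m, hm, hm'⟩ := ih this.2
          refine ⟨m + 1, ?_, ?_⟩
          · simp only [List.take_succ_cons, List.count_cons]
            omega
          · simp only [List.take_succ_cons, List.count_cons, hm']
            simp; omega
    obtain ⟨m, hm, hm'⟩ := hpre
    have hsplit : ∃ t, (List.range L).flatMap f = (List.range (i + 1)).flatMap f ++ t := by
      refine ⟨((List.range' (i + 1) (L - (i + 1)))).flatMap f, ?_⟩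
      rw [← List.flatMap_append, List.range_eq_range', List.range_eq_range']
      congr 1
      have := @List.range'_append_1 0 (i + 1) (L - (i + 1))
      rw [Nat.zero_add] at this
      rw [this]
      congr 1
      omega
    obtain ⟨t, ht⟩ := hsplit
    by_cases hm1 : m ≤ (f i).length
    · have := h (((List.range i).flatMap f).length + m) (k + 1) (by omega)
      rw [ht, List.range_succ, List.flatMap_append, List.append_assoc, List.take_length_add_append,
        List.count_append, List.count_append] at this
      simp only [List.flatMap_cons, List.flatMap_nil, List.append_nil] at this
      rw [List.take_append_of_le_length hm1, show k + 1 + 1 = k + 2 from rfl] at this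
      rw [List.range_succ, List.flatMap_append, List.count_append]
      simp only [List.flatMap_cons, List.flatMap_nil, List.append_nil]
      omega
    · rw [List.take_of_length_le (by omega)] at hm'
      have := h ((List.range (i + 1)).flatMap f).length (k + 1) (by omega)
      rw [ht, List.take_left, show k + 1 + 1 = k + 2 from rfl] at this
      rw [List.range_succ, List.flatMap_append, List.count_append, List.count_append] at *
      simp only [List.flatMap_cons, List.flatMap_nil, List.append_nil] at *
      omega
  · intro h n i hi
    obtain ⟨k, rfl⟩ : ∃ k, i = k + 1 := ⟨i - 1, by omega⟩
    obtain ⟨r, m, hr, he, h0⟩ := take_flatMap_range f L n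
    rw [he, List.count_append, List.count_append]
    have h1 : ((f r).take m).count (k + 2) ≤ (f r).count (k + 2) :=
      (List.take_sublist m (f r)).count_le _
    rcases hr.lt_or_eq with hr | hr
    · have := h r hr k
      rw [List.range_succ, List.flatMap_append, List.count_append] at this
      simp only [List.flatMap_cons, List.flatMap_nil, List.append_nil] at this
      show _ + ((f r).take m).count (k + 2) ≤ _
      have : List.count (k + 1 + 1) (List.flatMap f (List.range r)) =
        List.count (k + 2) (List.flatMap f (List.range r)) := rfl
      omega
    -- The prefix is the whole word, so the condition at the last block suffices.
    · rw [h0 hr, hr]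
      simp only [List.take_zero, List.count_nil, add_zero]
      rcases L with _ | L
      · simp
      · refine (h L (by omega) k).trans ?_
        rw [List.range_succ, List.flatMap_append, List.count_append]
        omega


/-! ### From tableaux to arrays of counts. -/

/-- The entries of row `i` of a filling of `lam / μ`, read from right to left. -/
def rowWord (lam μ : YoungDiagram) (T : ℕ → ℕ → ℕ) (i : ℕ) : List ℕ :=
  (List.range' (μ.rowLen i) (lam.rowLen i - μ.rowLen i)).reverse.map (T i)

/-- The number of entries `k + 1` in the rows before row `i`. -/
def letterCount (lam μ : YoungDiagram) (T : ℕ → ℕ → ℕ) (i k : ℕ) : ℕ :=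
  ∑ r ∈ Finset.range i, ((Finset.Ico (μ.rowLen r) (lam.rowLen r)).filter (T r · = k + 1)).card

/-- The number of boxes of row `i` that are in `μ` or carry an entry at most `k`. -/
def rowBound (lam μ : YoungDiagram) (T : ℕ → ℕ → ℕ) (i k : ℕ) : ℕ :=
  μ.rowLen i + ((Finset.Ico (μ.rowLen i) (lam.rowLen i)).filter (T i · ≤ k)).card

theorem count_rowWord (lam μ : YoungDiagram) (T : ℕ → ℕ → ℕ) (i x : ℕ) :
    (rowWord lam μ T i).count x =
      ((Finset.Ico (μ.rowLen i) (lam.rowLen i)).filter (T i · = x)).card := by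
  have h : Finset.Ico (μ.rowLen i) (lam.rowLen i) =
      (List.range' (μ.rowLen i) (lam.rowLen i - μ.rowLen i)).toFinset := by
    ext j
    simp only [Finset.mem_Ico, List.mem_toFinset, List.mem_range'_1]
    omega
  have h' : (Finset.Ico (μ.rowLen i) (lam.rowLen i)).filter (T i · = x) =
      ((List.range' (μ.rowLen i) (lam.rowLen i - μ.rowLen i)).filter (T i · = x)).toFinset := by
    ext j
    rw [h]
    simp
  rw [h', List.toFinset_card_of_nodup (List.Nodup.filter _ List.nodup_range'), rowWord,
    List.map_reverse, List.count_reverse, List.count, List.countP_map, List.countP_eq_length_filter]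
  rfl

theorem count_flatMap_rowWord (lam μ : YoungDiagram) (T : ℕ → ℕ → ℕ) (i k : ℕ) :
    ((List.range i).flatMap (rowWord lam μ T)).count (k + 1) = letterCount lam μ T i k := by
  induction i with
  | zero => simp [letterCount]
  | succ i ih =>
    rw [List.range_succ, List.flatMap_append, List.count_append, ih, letterCount, letterCount,
      Finset.sum_range_succ]
    simp [count_rowWord]

theorem card_filter_skewCells (lam μ : YoungDiagram) (T : ℕ → ℕ → ℕ) (k i : ℕ)
    (hi : lam.colLen 0 ≤ i) :
    ((skewCells lam μ).filter fun c => T c.1 c.2 = k + 1).card = letterCount lam μ T i k := by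
  have hmaps : ∀ c ∈ (skewCells lam μ).filter fun c => T c.1 c.2 = k + 1,
      c.1 ∈ Finset.range i := by
    rintro ⟨r, j⟩ hc
    rw [Finset.mem_filter, mem_skewCells] at hc
    by_contra hr
    rw [Finset.mem_range] at hr
    have := rowLen_eq_zero (by omega : lam.colLen 0 ≤ r)
    omega
  rw [Finset.card_eq_sum_card_fiberwise hmaps, letterCount]
  refine Finset.sum_congr rfl fun r _ => ?_
  refine Finset.card_bij' (fun c _ => c.2) (fun j _ => (r, j)) ?_ ?_ ?_ ?_
  · rintro ⟨r', j⟩ hc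
    simp only [Finset.mem_filter, mem_skewCells] at hc
    obtain ⟨⟨hc, h⟩, rfl⟩ := hc
    simp only [Finset.mem_filter, Finset.mem_Ico]
    exact ⟨hc, h⟩
  · intro j hj
    simp only [Finset.mem_filter, Finset.mem_Ico] at hj
    simp only [Finset.mem_filter, mem_skewCells]
    exact ⟨hj, trivial⟩
  · rintro ⟨r', j⟩ hc
    simp only [Finset.mem_filter] at hc
    simp [hc.2]
  · simp

theorem reverseRowWord_eq (lam μ : YoungDiagram) (T : ℕ → ℕ → ℕ) :
    reverseRowWord lam μ T = (List.range (lam.colLen 0)).flatMap (rowWord lam μ T) := rfl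

theorem rowBound_succ (lam μ : YoungDiagram) (T : ℕ → ℕ → ℕ) (i k : ℕ) :
    rowBound lam μ T i (k + 1) + letterCount lam μ T i k =
      rowBound lam μ T i k + letterCount lam μ T (i + 1) k := by
  have : (Finset.Ico (μ.rowLen i) (lam.rowLen i)).filter (T i · ≤ k + 1) =
      (Finset.Ico (μ.rowLen i) (lam.rowLen i)).filter (T i · ≤ k) ∪
        (Finset.Ico (μ.rowLen i) (lam.rowLen i)).filter (T i · = k + 1) := by
    ext j
    simp only [Finset.mem_filter, Finset.mem_union, Finset.mem_Ico]
    omega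
  rw [rowBound, rowBound, letterCount, letterCount, Finset.sum_range_succ, this,
    Finset.card_union_of_disjoint]
  · omega
  · rw [Finset.disjoint_filter]
    intro j _ h1 h2
    omega

theorem rowWord_pairwise {lam μ : YoungDiagram} {T : ℕ → ℕ → ℕ} {i : ℕ}
    (h : ∀ j j', μ.rowLen i ≤ j → j ≤ j' → j' < lam.rowLen i → T i j ≤ T i j') :
    (rowWord lam μ T i).Pairwise (· ≥ ·) := by
  rw [rowWord, List.map_reverse, List.pairwise_reverse, List.pairwise_map]
  refine List.Pairwise.imp_of_mem ?_ (List.pairwise_lt_range' (step := 1))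
  intro a b ha hb hab
  rw [List.mem_range'_1] at ha hb
  exact h a b (by omega) hab.le (by omega)

namespace IsLRTableau

variable {lam μ ν : YoungDiagram} {T : ℕ → ℕ → ℕ}

theorem row_mono (hT : IsLRTableau lam μ ν T) (i j j' : ℕ) (hj : μ.rowLen i ≤ j) (hjj : j ≤ j')
    (hj' : j' < lam.rowLen i) : T i j ≤ T i j' := by
  induction j', hjj using Nat.le_induction with
  | base => rfl
  | succ j' hjj ih =>
    exact (ih (by omega)).trans (hT.row_weak i j' (mem_skewCells.2 (by omega))
      (mem_skewCells.2 (by omega)))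

/-- Rows increase weakly, so the entries at most `k` fill an initial segment of the row, ending at
column `rowBound`. In particular `rowBound` determines `T`. -/
theorem le_iff_lt_rowBound (hT : IsLRTableau lam μ ν T) {i j k : ℕ} (hj : μ.rowLen i ≤ j)
    (hj' : j < lam.rowLen i) : T i j ≤ k ↔ j < rowBound lam μ T i k := by
  constructor
  · intro h
    have hsub : Finset.Ico (μ.rowLen i) (j + 1) ⊆
        (Finset.Ico (μ.rowLen i) (lam.rowLen i)).filter (T i · ≤ k) := by
      intro x hx
      rw [Finset.mem_Ico] at hx
      rw [Finset.mem_filter, Finset.mem_Ico]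
      exact ⟨by omega, (hT.row_mono i x j hx.1 (by omega) hj').trans h⟩
    have := Finset.card_le_card hsub
    rw [Nat.card_Ico] at this
    rw [rowBound]
    omega
  · intro h
    by_contra hc
    have hsub : (Finset.Ico (μ.rowLen i) (lam.rowLen i)).filter (T i · ≤ k) ⊆
        Finset.Ico (μ.rowLen i) j := by
      intro x hx
      rw [Finset.mem_filter, Finset.mem_Ico] at hx
      rw [Finset.mem_Ico]
      refine ⟨hx.1.1, ?_⟩
      by_contra hxj
      have := hT.row_mono i j x hj (by omega) hx.1.2
      omega
    have := Finset.card_le_card hsub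
    rw [Nat.card_Ico] at this
    rw [rowBound] at h
    omega

theorem rowLen_le (hT : IsLRTableau lam μ ν T) (i : ℕ) : μ.rowLen i ≤ lam.rowLen i :=
  le_iff_rowLen.1 hT.le i

theorem rowBound_le (hT : IsLRTableau lam μ ν T) (i k : ℕ) :
    rowBound lam μ T i k ≤ lam.rowLen i := by
  have := Finset.card_filter_le (Finset.Ico (μ.rowLen i) (lam.rowLen i)) (T i · ≤ k)
  rw [Nat.card_Ico] at this
  have := hT.rowLen_le i
  rw [rowBound]
  omega

theorem letterCount_succ_le (hT : IsLRTableau lam μ ν T) (i k : ℕ) :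
    letterCount lam μ T (i + 1) (k + 1) ≤ letterCount lam μ T i k := by
  by_cases hi : i < lam.colLen 0
  · have h := hT.lattice
    rw [reverseRowWord_eq, isLatticeWord_flatMap_range fun i => rowWord_pairwise (hT.row_mono i)] at h
    have := h i hi k
    rw [show k + 2 = (k + 1) + 1 from rfl] at this
    exact (count_flatMap_rowWord lam μ T _ _).symm.trans_le
      (this.trans_eq (count_flatMap_rowWord lam μ T _ _))
  -- Past the last row the counts have reached the content, and the claim is that `ν` is a
  -- partition.
  · rw [← card_filter_skewCells lam μ T k i (by omega), hT.content,
      ← card_filter_skewCells lam μ T (k + 1) (i + 1) (by omega), hT.content]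
    exact ν.rowLen_anti _ _ (Nat.le_succ k)

/-- This is column strictness: above a box with entry at most `k + 1` lies a box of `μ` or one with
entry at most `k`. -/
theorem rowBound_succ_le (hT : IsLRTableau lam μ ν T) (i k : ℕ) :
    rowBound lam μ T (i + 1) (k + 1) ≤ rowBound lam μ T i k := by
  refine le_of_forall_lt fun j hj => ?_
  have h1 := hT.rowBound_le (i + 1) (k + 1)
  have h2 := lam.rowLen_anti i (i + 1) (Nat.le_succ i)
  have h3 := μ.rowLen_anti i (i + 1) (Nat.le_succ i)
  by_cases hμ : j < μ.rowLen i
  · rw [rowBound]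
    omega
  · have hjl := hj.trans_le h1
    rw [← hT.le_iff_lt_rowBound (by omega) (by omega)]
    rw [← hT.le_iff_lt_rowBound (by omega) (by omega)] at hj
    have := hT.col_strict i j (mem_skewCells.2 (by omega)) (mem_skewCells.2 (by omega))
    omega

theorem isHive (hT : IsLRTableau lam μ ν T) :
    IsHive lam.rowLen μ.rowLen ν.rowLen (letterCount lam μ T) (rowBound lam μ T) where
  zero k := by simp [letterCount]
  mono i k := by rw [letterCount, letterCount, Finset.sum_range_succ]; omega
  lat := hT.letterCount_succ_le
  left i := by
    rw [rowBound, Finset.filter_false_of_mem, Finset.card_empty, add_zero]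
    intro j hj
    rw [Finset.mem_Ico] at hj
    have := hT.pos i j (mem_skewCells.2 hj)
    omega
  rel := rowBound_succ lam μ T
  col := hT.rowBound_succ_le
  right i := by
    -- An entry above `i + 1` in row `i` would make a count positive that the lattice condition
    -- forces to be zero.
    have h : ∀ i j, μ.rowLen i ≤ j → j < lam.rowLen i → T i j ≤ i + 1 := by
      intro i j hj hj'
      by_contra hlt
      have h0 : ∀ i k, i ≤ k → letterCount lam μ T i k = 0 := by
        intro i
        induction i with
        | zero => simp [letterCount]
        | succ i ih =>
          intro k hk
          obtain ⟨k, rfl⟩ : ∃ m, k = m + 1 := ⟨k - 1, by omega⟩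
          have := hT.letterCount_succ_le i k
          rw [ih k (by omega)] at this
          omega
      have := h0 (i + 1) (T i j - 1) (by omega)
      rw [letterCount, Finset.sum_eq_zero_iff] at this
      have := this i (Finset.self_mem_range_succ i)
      rw [Finset.card_eq_zero, Finset.filter_eq_empty_iff] at this
      exact this (Finset.mem_Ico.2 ⟨hj, hj'⟩) (by omega)
    rw [rowBound, Finset.filter_true_of_mem, Nat.card_Ico]
    · have := hT.rowLen_le i
      omega
    · intro j hj
      rw [Finset.mem_Ico] at hj
      exact h i j hj.1 hj.2
  content := ⟨lam.colLen 0, fun i hi k => by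
    rw [← card_filter_skewCells lam μ T k i hi, hT.content]⟩

end IsLRTableau

/-! ### From arrays of counts back to tableaux. -/

/-- The filling of `lam / μ` in which the number of boxes of row `i` that belong to `μ` or carry
an entry at most `k` is `M i k`. -/
def fillingOfRowBound (lam μ : YoungDiagram) (M : ℕ → ℕ → ℕ) (i j : ℕ) : ℕ :=
  if (i, j) ∈ skewCells lam μ then ((Finset.range (i + 1)).filter (M i · ≤ j)).card else 0

namespace IsHive

variable {lam μ ν : YoungDiagram} {N M : ℕ → ℕ → ℕ}

/-- Since `M i` is monotone, the number of `x` with `M i x ≤ j` is the least `x` with `j < M i x`.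
Restricting to `x ≤ i` loses nothing because `M i (i + 1)` is already the full row length. -/
theorem fillingOfRowBound_le_iff (h : IsHive lam.rowLen μ.rowLen ν.rowLen N M) {i j k : ℕ}
    (hj : μ.rowLen i ≤ j) (hj' : j < lam.rowLen i) :
    fillingOfRowBound lam μ M i j ≤ k ↔ j < M i k := by
  rw [fillingOfRowBound, if_pos (mem_skewCells.2 ⟨hj, hj'⟩)]
  by_cases hk : i + 1 ≤ k
  · rw [h.eq_right_of_le hk]
    have := Finset.card_filter_le (Finset.range (i + 1)) (M i · ≤ j)
    rw [Finset.card_range] at this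
    exact iff_of_true (this.trans hk) hj'
  constructor
  · intro hc
    by_contra hM
    have hsub : Finset.range (k + 1) ⊆ (Finset.range (i + 1)).filter (M i · ≤ j) := by
      intro x hx
      rw [Finset.mem_range] at hx
      rw [Finset.mem_filter, Finset.mem_range]
      have := h.row_mono i (by omega : x ≤ k)
      omega
    have := Finset.card_le_card hsub
    rw [Finset.card_range] at this
    omega
  · intro hM
    have hsub : (Finset.range (i + 1)).filter (M i · ≤ j) ⊆ Finset.range k := by
      intro x hx
      rw [Finset.mem_filter] at hx
      rw [Finset.mem_range]
      by_contra hxk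
      have := h.row_mono i (by omega : k ≤ x)
      omega
    have := Finset.card_le_card hsub
    rwa [Finset.card_range] at this

theorem rowBound_fillingOfRowBound (h : IsHive lam.rowLen μ.rowLen ν.rowLen N M) :
    rowBound lam μ (fillingOfRowBound lam μ M) = M := by
  funext i k
  have : (Finset.Ico (μ.rowLen i) (lam.rowLen i)).filter (fillingOfRowBound lam μ M i · ≤ k) =
      Finset.Ico (μ.rowLen i) (M i k) := by
    ext j
    have := h.le_right i k
    rw [Finset.mem_filter, Finset.mem_Ico, Finset.mem_Ico]
    constructor
    · rintro ⟨hj, hj'⟩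
      exact ⟨hj.1, (h.fillingOfRowBound_le_iff hj.1 hj.2).1 hj'⟩
    · rintro ⟨hj, hj'⟩
      exact ⟨⟨hj, by omega⟩, (h.fillingOfRowBound_le_iff hj (by omega)).2 hj'⟩
  have := h.left_le i k
  rw [rowBound, ‹Finset.filter _ _ = _›, Nat.card_Ico]
  omega

theorem letterCount_fillingOfRowBound (h : IsHive lam.rowLen μ.rowLen ν.rowLen N M) :
    letterCount lam μ (fillingOfRowBound lam μ M) = N := by
  funext i k
  induction i with
  | zero => rw [h.zero]; simp [letterCount]
  | succ i ih =>
    have h1 := rowBound_succ lam μ (fillingOfRowBound lam μ M) i k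
    have h2 := h.rel i k
    rw [h.rowBound_fillingOfRowBound] at h1
    omega

theorem isLRTableau (h : IsHive lam.rowLen μ.rowLen ν.rowLen N M) :
    IsLRTableau lam μ ν (fillingOfRowBound lam μ M) := by
  have hmono : ∀ i j j', μ.rowLen i ≤ j → j ≤ j' → j' < lam.rowLen i →
      fillingOfRowBound lam μ M i j ≤ fillingOfRowBound lam μ M i j' := by
    intro i j j' hj hjj hj'
    rw [h.fillingOfRowBound_le_iff hj (by omega)]
    exact hjj.trans_lt ((h.fillingOfRowBound_le_iff (by omega) hj').1 le_rfl)
  refine ⟨?_, ?_, ?_, ?_, ?_, ?_, ?_⟩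
  · rw [le_iff_rowLen]
    intro i
    rw [← h.left i]
    exact h.le_right i 0
  · intro i j hij
    rw [fillingOfRowBound, if_neg hij]
  · intro i j hij
    rw [mem_skewCells] at hij
    by_contra hc
    have := (h.fillingOfRowBound_le_iff (k := 0) hij.1 hij.2).1 (by omega)
    rw [h.left] at this
    omega
  · intro i j h1 h2
    rw [mem_skewCells] at h1 h2
    exact hmono i j (j + 1) h1.1 (Nat.le_succ j) h2.2
  · intro i j h1 h2
    rw [mem_skewCells] at h1 h2
    by_contra hc
    rw [not_lt] at hc
    have h3 := (h.fillingOfRowBound_le_iff h1.1 h1.2).1 le_rfl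
    -- The value `0` would put the box inside `μ`; for a value `k + 1`, `col` lowers the bound on
    -- the upper entry to `k`, a contradiction.
    by_cases h0 : fillingOfRowBound lam μ M i j = 0
    · rw [h0, h.left] at h3
      omega
    · obtain ⟨k, hk⟩ := Nat.exists_eq_succ_of_ne_zero h0
      have h4 := (h.fillingOfRowBound_le_iff h2.1 h2.2).1 (hk ▸ hc)
      have h5 := h.col i k
      have := (h.fillingOfRowBound_le_iff h1.1 h1.2).2 (h4.trans_le h5)
      omega
  · intro k
    rw [card_filter_skewCells lam μ _ k (lam.colLen 0) le_rfl, h.letterCount_fillingOfRowBound,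
      h.eq_content (fun i => rowLen_eq_zero) le_rfl]
  · rw [reverseRowWord_eq, isLatticeWord_flatMap_range fun i => rowWord_pairwise (hmono i)]
    intro i _ k
    rw [show k + 2 = (k + 1) + 1 from rfl, count_flatMap_rowWord, count_flatMap_rowWord,
      h.letterCount_fillingOfRowBound]
    exact h.lat i k

end IsHive

/-- Littlewood-Richardson tableaux correspond to their arrays of counts. -/
noncomputable def hiveEquiv (lam μ ν : YoungDiagram) :
    {T : ℕ → ℕ → ℕ // IsLRTableau lam μ ν T} ≃
      {p : (ℕ → ℕ → ℕ) × (ℕ → ℕ → ℕ) // IsHive lam.rowLen μ.rowLen ν.rowLen p.1 p.2} :=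
  Equiv.ofBijective (fun T => ⟨(letterCount lam μ T.1, rowBound lam μ T.1), T.2.isHive⟩) <| by
    constructor
    · rintro ⟨T, hT⟩ ⟨S, hS⟩ hTS
      have hb : rowBound lam μ T = rowBound lam μ S :=
        congrArg (fun p => p.1.2) hTS
      refine Subtype.ext (funext fun i => funext fun j => ?_)
      by_cases hc : (i, j) ∈ skewCells lam μ
      · have hc' := mem_skewCells.1 hc
        refine eq_of_forall_ge_iff fun k => ?_
        rw [hT.le_iff_lt_rowBound hc'.1 hc'.2, hS.le_iff_lt_rowBound hc'.1 hc'.2, hb]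
      · exact (hT.zeros i j hc).trans (hS.zeros i j hc).symm
    · rintro ⟨⟨N, M⟩, h⟩
      exact ⟨⟨fillingOfRowBound lam μ M, h.isLRTableau⟩,
        Subtype.ext (Prod.ext h.letterCount_fillingOfRowBound h.rowBound_fillingOfRowBound)⟩

theorem lrCoeff_eq_card_hives (lam μ ν : YoungDiagram) :
    lrCoeff lam μ ν = Nat.card
      {p : (ℕ → ℕ → ℕ) × (ℕ → ℕ → ℕ) // IsHive lam.rowLen μ.rowLen ν.rowLen p.1 p.2} :=
  Nat.card_congr (hiveEquiv lam μ ν)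

theorem finite_hives (lam μ ν : YoungDiagram) : Finite
    {p : (ℕ → ℕ → ℕ) × (ℕ → ℕ → ℕ) // IsHive lam.rowLen μ.rowLen ν.rowLen p.1 p.2} :=
  have := finite_lrTableaux lam μ ν
  Finite.of_equiv _ (hiveEquiv lam μ ν)

/-! ### The first inequality: adding a column. -/

/-- These are the counts of the column filled downwards with `1, …, a - b`: the entry `k + 1` stands
in row `b + k`. -/
theorem isHive_column {a b : ℕ} (hab : b ≤ a) :
    IsHive (fun i => if i < a then 1 else 0) (fun i => if i < b then 1 else 0)
      (fun k => if k < a - b then 1 else 0) (fun i k => if k < a - b ∧ b + k < i then 1 else 0)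
      (fun i k => if i < a ∧ i < b + k then 1 else 0) where
  zero k := by simp
  mono i k := by split_ifs <;> omega
  lat i k := by split_ifs <;> omega
  left i := by split_ifs <;> omega
  rel i k := by split_ifs <;> omega
  col i k := by split_ifs <;> omega
  right i := by split_ifs <;> omega
  content := ⟨a, fun i hi k => by split_ifs <;> omega⟩

theorem IsHive.add {lam μ ν lam' μ' ν' : ℕ → ℕ} {N M N' M' : ℕ → ℕ → ℕ}
    (h : IsHive lam μ ν N M) (h' : IsHive lam' μ' ν' N' M') :
    IsHive (fun i => lam i + lam' i) (fun i => μ i + μ' i) (fun k => ν k + ν' k)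
      (fun i k => N i k + N' i k) (fun i k => M i k + M' i k) where
  zero k := by rw [h.zero, h'.zero]
  mono i k := Nat.add_le_add (h.mono i k) (h'.mono i k)
  lat i k := Nat.add_le_add (h.lat i k) (h'.lat i k)
  left i := by rw [h.left, h'.left]
  rel i k := by
    have := h.rel i k
    have := h'.rel i k
    omega
  col i k := Nat.add_le_add (h.col i k) (h'.col i k)
  right i := by rw [h.right, h'.right]
  content := by
    obtain ⟨L, hL⟩ := h.content
    obtain ⟨L', hL'⟩ := h'.content
    exact ⟨max L L', fun i hi k => by rw [hL i (by omega), hL' i (by omega)]⟩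

theorem lrCoeff_le_addColumn (lam μ ν : YoungDiagram) {a b : ℕ} (hab : b ≤ a) :
    lrCoeff lam μ ν ≤ lrCoeff (lam.addColumn a) (μ.addColumn b) (ν.addColumn (a - b)) := by
  have hfun : ∀ (κ : YoungDiagram) (n : ℕ),
      (κ.addColumn n).rowLen = fun i => κ.rowLen i + if i < n then 1 else 0 :=
    fun κ n => funext (κ.rowLen_addColumn n)
  rw [lrCoeff_eq_card_hives, lrCoeff_eq_card_hives]
  have := finite_hives (lam.addColumn a) (μ.addColumn b) (ν.addColumn (a - b))
  refine Nat.card_le_card_of_injective (fun p =>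
    ⟨(fun i k => p.1.1 i k + if k < a - b ∧ b + k < i then 1 else 0,
      fun i k => p.1.2 i k + if i < a ∧ i < b + k then 1 else 0), ?_⟩) ?_
  · rw [hfun, hfun, hfun]
    exact p.2.add (isHive_column hab)
  · rintro ⟨⟨N, M⟩, h⟩ ⟨⟨N', M'⟩, h'⟩ heq
    simp only [Subtype.mk.injEq, Prod.mk.injEq] at heq ⊢
    exact ⟨funext fun i => funext fun k => Nat.add_right_cancel (congrFun (congrFun heq.1 i) k),
      funext fun i => funext fun k => Nat.add_right_cancel (congrFun (congrFun heq.2 i) k)⟩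


/-! ### Dual column insertion and the Pieri bijection. -/

/-- One step of dual column insertion: the carries `c` travel towards smaller indices. -/
theorem exists_insertion_step {ρ κ τ : ℕ → ℕ} {n ε : ℕ} (hρκ : ∀ k, ρ k ≤ κ k)
    (hκρ : ∀ k, κ (k + 1) ≤ ρ k) (hρτ : ∀ k, ρ k ≤ τ k) (hτρ : ∀ k, τ k ≤ ρ k + 1)
    (hτ : ∀ k, τ (k + 1) ≤ τ k) (h0 : ∀ k, n ≤ k → τ k = 0) (hε : ε ≤ 1) :
    ∃ τ' c : ℕ → ℕ, c 0 = 0 ∧ (∀ k, n + 1 ≤ k → c k = ε) ∧ ∀ k, c k ≤ 1 ∧ κ k ≤ τ' k ∧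
      τ' k ≤ κ k + 1 ∧ τ k ≤ τ' k ∧ τ' (k + 1) ≤ τ k ∧ c (k + 1) + τ k + κ k = c k + τ' k + ρ k ∧
      (κ (k + 1) < τ k → c (k + 1) = 0) := by
  -- `F k s` is the carry leaving index `k` when `s` enters from `k + 1`. The surplus `τ k - ρ k +
  -- s` stays and raises `κ k` if `k = 0` or `τ (k - 1)` leaves room above `κ k`; otherwise it moves
  -- on. The recursion `g` runs down from index `n + 1`, where the carry is `ε`.
  let F : ℕ → ℕ → ℕ := fun k s => if k = 0 ∨ κ k < τ (k - 1) then 0 else τ k - ρ k + s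
  let g : ℕ → ℕ := fun m => Nat.rec ε (fun m s => F (n - m) s) m
  obtain ⟨c, hc⟩ : ∃ c : ℕ → ℕ, ∀ k, c k = g (n + 1 - k) := ⟨_, fun _ => rfl⟩
  have hg : ∀ m, g (m + 1) = F (n - m) (g m) := fun m => rfl
  have hlarge : ∀ k, n + 1 ≤ k → c k = ε := by
    intro k hk
    rw [hc, Nat.sub_eq_zero_of_le hk]
    rfl
  have hF : ∀ k, c k = F k (c (k + 1)) := by
    intro k
    by_cases hk : k ≤ n
    · rw [hc, hc, show n + 1 - k = (n - k) + 1 by omega, hg, show n - (n - k) = k by omega,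
        show n + 1 - (k + 1) = n - k by omega]
    · have h1 := h0 (k - 1) (by omega)
      have h2 := h0 k (by omega)
      rw [hlarge k (by omega), hlarge (k + 1) (by omega)]
      simp only [F]
      rw [if_neg (by omega)]
      omega
  have hzero : c 0 = 0 := by rw [hF]; simp [F]
  have hsucc : ∀ k, c (k + 1) =
      if κ (k + 1) < τ k then 0 else τ (k + 1) - ρ (k + 1) + c (k + 1 + 1) := by
    intro k
    rw [hF (k + 1)]
    simp [F]
  -- Two surpluses never meet: a nonzero carry into `k` means `τ k ≤ κ (k + 1) ≤ ρ k`, so `τ k - ρ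
  -- k` vanishes.
  have hs : ∀ m k, n ≤ k + m → τ k - ρ k + c (k + 1) ≤ 1 := by
    intro m
    induction m with
    | zero =>
      intro k hk
      rw [h0 k hk, hlarge (k + 1) (by omega)]
      omega
    | succ m ih =>
      intro k hk
      have h1 := ih (k + 1) (by omega)
      have h2 := hsucc k
      have h3 := hκρ k
      have h4 := hρτ k
      have h5 := hτρ k
      split_ifs at h2 <;> omega
  have hs' : ∀ k, τ k - ρ k + c (k + 1) ≤ 1 := fun k => hs n k (by omega)
  refine ⟨fun k => κ k + (τ k - ρ k + c (k + 1) - c k), c, hzero, hlarge, fun k => ?_⟩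
  have h1 := hs' k
  have h2 := hs' (k + 1)
  have h3 := hsucc k
  have h4 := hκρ k
  have h5 := hρκ k
  have h6 := hρτ k
  have h7 := hτρ k
  dsimp only
  rcases k with _ | k
  · split_ifs at h3 <;> omega
  · have h8 := hsucc k
    have h9 := hτ k
    split_ifs at h3 h8 <;> omega

/-- The inverse of `exists_insertion_step`. -/
theorem exists_extraction_step {κ τ τ' : ℕ → ℕ} (hκ : ∀ k, κ (k + 1) ≤ κ k)
    (hκτ : ∀ k, κ k ≤ τ' k) (hτκ : ∀ k, τ' k ≤ κ k + 1) (hτ : ∀ k, τ k ≤ τ' k)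
    (hτ' : ∀ k, τ' (k + 1) ≤ τ k) :
    ∃ ρ c : ℕ → ℕ, c 0 = 0 ∧ ∀ k, c k ≤ 1 ∧ ρ k ≤ τ k ∧ τ k ≤ ρ k + 1 ∧ ρ k ≤ κ k ∧
      κ (k + 1) ≤ ρ k ∧ c (k + 1) + τ k + κ k = c k + τ' k + ρ k ∧
      (κ (k + 1) < τ k → c (k + 1) = 0) := by
  -- The same carry rule, solved upwards from carry `0` at index `0`; the eventual carry is an
  -- output here.
  obtain ⟨c, hzero, hsucc⟩ : ∃ c : ℕ → ℕ, c 0 = 0 ∧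
      ∀ k, c (k + 1) = if κ (k + 1) < τ k then 0 else τ' k - κ k + c k :=
    ⟨fun k => Nat.rec 0 (fun k s => if κ (k + 1) < τ k then 0 else τ' k - κ k + s) k, rfl,
      fun _ => rfl⟩
  -- A nonzero carry into `k + 1` means `τ' (k + 1) ≤ τ k ≤ κ (k + 1)`, so no second surplus arises
  -- there.
  have hs : ∀ k, τ' k - κ k + c k ≤ 1 := by
    intro k
    induction k with
    | zero =>
      have := hτκ 0
      omega
    | succ k ih =>
      have h1 := hτκ (k + 1)
      have h2 := hsucc k
      have h3 := hτ' k
      split_ifs at h2 <;> omega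
  refine ⟨fun k => τ k - (τ' k - κ k + c k - c (k + 1)), c, hzero, fun k => ?_⟩
  have h1 := hs k
  have h2 := hsucc k
  have h3 := hκ k
  have h4 := hκτ k
  have h5 := hτκ k
  have h6 := hτ k
  have h7 := hτ' k
  have h8 := hκτ (k + 1)
  dsimp only
  split_ifs at h2 <;> omega

/-- The arrays `N', M'` arise from `N, M` by dual column insertion. -/
structure IsLinked (N M N' M' : ℕ → ℕ → ℕ) : Prop where
  letter_le : ∀ i k, N i k ≤ N' i k
  le_letter : ∀ i k, N' i k ≤ N i k + 1
  bound_le : ∀ i k, M i k ≤ M' i k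
  le_bound : ∀ i k, M' i k ≤ M i k + 1
  slack : ∀ i k, N (i + 1) (k + 1) < N' i k → M' i (k + 1) = M i (k + 1)

section

variable {lam σ μ ν : ℕ → ℕ} {N M N' M' : ℕ → ℕ → ℕ}

/-- Insertion is applied row by row, with initial carry `lam i - σ i` in row `i`. The carries are
exactly the differences `M' i k - M i k`: the balance equation of a step turns `rel` for `M` into
`rel` for `M'`, and the boundary carries give `left` and `right`. -/
theorem IsPrehive.exists_linked (h : IsPrehive σ μ N M) (hlam : ∀ i, lam (i + 1) ≤ lam i)
    (hσ : ∀ i, σ i ≤ lam i) (hσ' : ∀ i, lam i ≤ σ i + 1) :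
    ∃ N' M', IsPrehive lam μ N' M' ∧ IsLinked N M N' M' := by
  let V : ℕ → (ℕ → ℕ) → Prop := fun i τ => (∀ k, N i k ≤ τ k) ∧ (∀ k, τ k ≤ N i k + 1) ∧
    (∀ k, τ (k + 1) ≤ τ k) ∧ ∀ k, i ≤ k → τ k = 0
  have step : ∀ i τ, V i τ → ∃ τ' c : ℕ → ℕ, V (i + 1) τ' ∧ c 0 = 0 ∧
      (∀ k, i + 1 ≤ k → c k = lam i - σ i) ∧ ∀ k, c k ≤ 1 ∧ τ k ≤ τ' k ∧ τ' (k + 1) ≤ τ k ∧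
        c (k + 1) + τ k + N (i + 1) k = c k + τ' k + N i k ∧
        (N (i + 1) (k + 1) < τ k → c (k + 1) = 0) := by
    rintro i τ ⟨h1, h2, h3, h4⟩
    obtain ⟨τ', c, hc, hc', H⟩ := exists_insertion_step (h.mono i) (h.lat i) h1 h2 h3 h4
      (by have := hσ' i; omega : lam i - σ i ≤ 1)
    refine ⟨τ', c, ⟨fun k => (H k).2.1, fun k => (H k).2.2.1,
      fun k => (H k).2.2.2.2.1.trans (H k).2.2.2.1, fun k hk => ?_⟩, hc, hc',
      fun k => ⟨(H k).1, (H k).2.2.2⟩⟩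
    have := (H (k - 1)).2.2.2.2.1
    rw [show k - 1 + 1 = k by omega, h4 (k - 1) (by omega)] at this
    omega
  choose! f c hf using step
  obtain ⟨N', hN0, hNs⟩ : ∃ N' : ℕ → ℕ → ℕ, (N' 0 = fun _ => 0) ∧ ∀ i, N' (i + 1) = f i (N' i) :=
    ⟨fun i => Nat.rec (fun _ => 0) f i, rfl, fun _ => rfl⟩
  have hV : ∀ i, V i (N' i) := by
    intro i
    induction i with
    | zero => simp [V, hN0, h.zero]
    | succ i ih => rw [hNs]; exact (hf i _ ih).1
  obtain ⟨d, hd⟩ : ∃ d : ℕ → ℕ → ℕ, ∀ i, d i = c i (N' i) := ⟨_, fun _ => rfl⟩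
  have H : ∀ i, d i 0 = 0 ∧ (∀ k, i + 1 ≤ k → d i k = lam i - σ i) ∧ ∀ k, d i k ≤ 1 ∧
      N' i k ≤ N' (i + 1) k ∧ N' (i + 1) (k + 1) ≤ N' i k ∧
      d i (k + 1) + N' i k + N (i + 1) k = d i k + N' (i + 1) k + N i k ∧
      (N (i + 1) (k + 1) < N' i k → d i (k + 1) = 0) := by
    intro i
    rw [hd, hNs]
    exact (hf i _ (hV i)).2
  have hlarge : ∀ i k, i + 1 ≤ k → M i k + d i k = lam i := by
    intro i k hk
    rw [h.eq_right_of_le hk, (H i).2.1 k hk]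
    have := hσ i
    omega
  -- Downward induction on `k`, starting where the bound reads `lam (i + 1) ≤ lam i`. A failure
  -- needs equality in `h.col` with `d (i + 1) (k + 1) = 1` and `d i k = 0`. The carry rule and the
  -- bound at `k + 1` then force `N' i k = N i k = N (i + 1) (k + 1)` and `N' (i + 1) (k + 1) > N (i
  -- + 1) (k + 1)`, against the lattice inequality for `N'`.
  have hcol : ∀ i m k, i + 1 ≤ k + m → M (i + 1) (k + 1) + d (i + 1) (k + 1) ≤ M i k + d i k := by
    intro i m
    induction m with
    | zero =>
      intro k hk
      rw [hlarge _ _ (by omega), hlarge _ _ (by omega)]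
      exact hlam i
    | succ m ih =>
      intro k hk
      have h1 := ih (k + 1) (by omega)
      have h2 := h.col i k
      have h3 := h.col i (k + 1)
      have h4 := h.rel i k
      have h5 := h.rel (i + 1) (k + 1)
      have h6 := h.lat i k
      have h7 := h.lat (i + 1) k
      obtain ⟨a1, a2, a3, a4, a5⟩ := (H i).2.2 k
      obtain ⟨b1, b2, b3, b4, b5⟩ := (H (i + 1)).2.2 k
      obtain ⟨c1, c2, c3, c4, c5⟩ := (H (i + 1)).2.2 (k + 1)
      have e1 := (hV i).1 k
      have e2 := (hV (i + 1)).1 k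
      have e3 := (hV (i + 1)).1 (k + 1)
      have e4 := (hV (i + 1 + 1)).1 (k + 1)
      omega
  refine ⟨N', fun i k => M i k + d i k, ⟨?_, ?_, ?_, ?_, ?_, ?_, ?_⟩, ⟨?_, ?_, ?_, ?_, ?_⟩⟩
  · exact fun k => congrFun hN0 k
  · exact fun i k => ((H i).2.2 k).2.1
  · exact fun i k => ((H i).2.2 k).2.2.1
  · exact fun i => by rw [(H i).1, h.left, add_zero]
  · intro i k
    have := h.rel i k
    have := ((H i).2.2 k).2.2.2.1
    omega
  · exact fun i k => hcol i (i + 1) k (by omega)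
  · exact fun i => hlarge i (i + 1) le_rfl
  · exact fun i => (hV i).1
  · exact fun i => (hV i).2.1
  · exact fun i k => Nat.le_add_right _ _
  · exact fun i k => Nat.add_le_add_left ((H i).2.2 k).1 _
  · exact fun i k hk => by rw [((H i).2.2 k).2.2.2.2 hk, add_zero]

/-- Extraction is applied from row `L`, where the counts are set to `ν`, up to row `0`. The outer
shape is not prescribed but read off as `M i (i + 1)`. -/
theorem IsPrehive.exists_linked_of_content (h : IsPrehive lam μ N' M')
    (hν : ∀ k, ν (k + 1) ≤ ν k) {L : ℕ} (hL : ∀ i, L ≤ i → ∀ k, N' i k = N' L k)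
    (hle : ∀ k, ν k ≤ N' L k) (hle' : ∀ k, N' L k ≤ ν k + 1) :
    ∃ N M, IsHive (fun i => M i (i + 1)) μ ν N M ∧ IsLinked N M N' M' := by
  let W : ℕ → (ℕ → ℕ) → Prop := fun i ρ =>
    (∀ k, ρ k ≤ N' i k) ∧ (∀ k, N' i k ≤ ρ k + 1) ∧ ∀ k, ρ (k + 1) ≤ ρ k
  have step : ∀ i κ, W (i + 1) κ → ∃ ρ c : ℕ → ℕ, W i ρ ∧ c 0 = 0 ∧ ∀ k, c k ≤ 1 ∧ ρ k ≤ κ k ∧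
      κ (k + 1) ≤ ρ k ∧ c (k + 1) + N' i k + κ k = c k + N' (i + 1) k + ρ k ∧
      (κ (k + 1) < N' i k → c (k + 1) = 0) := by
    rintro i κ ⟨h1, h2, h3⟩
    obtain ⟨ρ, c, hc, H⟩ := exists_extraction_step h3 h1 h2 (h.mono i) (h.lat i)
    exact ⟨ρ, c, ⟨fun k => (H k).2.1, fun k => (H k).2.2.1,
      fun k => (H (k + 1)).2.2.2.1.trans (H k).2.2.2.2.1⟩, hc, fun k => ⟨(H k).1, (H k).2.2.2⟩⟩
  choose! f c hf using step
  let R : ℕ → ℕ → ℕ := fun m => Nat.rec ν (fun m κ => f (L - m - 1) κ) m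
  obtain ⟨N, hN⟩ : ∃ N : ℕ → ℕ → ℕ, ∀ i, N i = R (L - i) := ⟨_, fun _ => rfl⟩
  have hlarge : ∀ i, L ≤ i → N i = ν := by
    intro i hi
    rw [hN, Nat.sub_eq_zero_of_le hi]
    rfl
  have hsmall : ∀ i, i < L → N i = f i (N (i + 1)) := by
    intro i hi
    have hR : ∀ m, R (m + 1) = f (L - m - 1) (R m) := fun _ => rfl
    rw [hN, hN, show L - i = (L - (i + 1)) + 1 by omega, hR,
      show L - (L - (i + 1)) - 1 = i by omega]
  have hW : ∀ m i, L ≤ i + m → W i (N i) := by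
    intro m
    induction m with
    | zero =>
      intro i hi
      rw [hlarge i hi]
      exact ⟨fun k => by rw [hL i hi]; exact hle k, fun k => by rw [hL i hi]; exact hle' k, hν⟩
    | succ m ih =>
      intro i hi
      by_cases hiL : i < L
      · rw [hsmall i hiL]
        exact (hf i _ (ih (i + 1) (by omega))).1
      · exact ih i (by omega)
  replace hW : ∀ i, W i (N i) := fun i => hW L i (by omega)
  have H : ∀ i, ∃ d : ℕ → ℕ, d 0 = 0 ∧ ∀ k, d k ≤ 1 ∧ N i k ≤ N (i + 1) k ∧
      N (i + 1) (k + 1) ≤ N i k ∧ d (k + 1) + N' i k + N (i + 1) k = d k + N' (i + 1) k + N i k ∧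
      (N (i + 1) (k + 1) < N' i k → d (k + 1) = 0) := by
    intro i
    by_cases hi : i < L
    · have := (hf i _ (hW (i + 1))).2
      rw [← hsmall i hi] at this
      exact ⟨_, this⟩
    -- From row `L` on both arrays of letter counts are constant, so nothing is carried.
    · refine ⟨fun _ => 0, rfl, fun k => ?_⟩
      rw [hlarge i (by omega), hlarge (i + 1) (by omega), hL i (by omega), hL (i + 1) (by omega)]
      exact ⟨zero_le_one, le_rfl, hν k, rfl, fun _ => rfl⟩
  choose d hd0 H using H
  obtain ⟨M, hM0, hMs⟩ : ∃ M : ℕ → ℕ → ℕ, (∀ i, M i 0 = μ i) ∧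
      ∀ i k, M i (k + 1) = M i k + (N (i + 1) k - N i k) :=
    ⟨fun i k => Nat.rec (μ i) (fun k m => m + (N (i + 1) k - N i k)) k, fun _ => rfl,
      fun _ _ => rfl⟩
  have hM : ∀ i k, M' i k = M i k + d i k := by
    intro i k
    induction k with
    | zero => rw [h.left, hM0, hd0, add_zero]
    | succ k ih =>
      have := h.rel i k
      have := hMs i k
      obtain ⟨_, _, _, _, _⟩ := H i k
      omega
  have hcol : ∀ i k, M (i + 1) (k + 1) ≤ M i k := by
    intro i k
    induction k with
    | zero =>
      have h1 := h.col i 0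
      have h2 := hM (i + 1) (0 + 1)
      rw [h.left] at h1
      rw [hM0]
      omega
    | succ k ih =>
      have h1 := h.col i k
      have h2 := h.col i (k + 1)
      have h3 := h.rel i k
      have h4 := h.rel (i + 1) (k + 1)
      have h5 := h.lat (i + 1) k
      have h6 := h.lat i k
      have m1 := hM i k
      have m2 := hM i (k + 1)
      have m3 := hM (i + 1) (k + 1)
      have m4 := hM (i + 1) (k + 1 + 1)
      obtain ⟨a1, a2, a3, a4, a5⟩ := H i k
      obtain ⟨b1, b2, b3, b4, b5⟩ := H (i + 1) k
      obtain ⟨c1, c2, c3, c4, c5⟩ := H (i + 1) (k + 1)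
      have a6 := (H i (k + 1)).1
      have e1 := (hW i).1 k
      have e2 := (hW (i + 1)).1 k
      have e3 := (hW (i + 1)).1 (k + 1)
      have e4 := (hW (i + 1 + 1)).1 (k + 1)
      have e5 := (hW (i + 1)).2.1 k
      have e6 := (hW (i + 1 + 1)).2.1 (k + 1)
      omega
  refine ⟨N, M, ⟨⟨?_, ?_, ?_, hM0, ?_, hcol, fun _ => rfl⟩, ?_⟩, ⟨?_, ?_, ?_, ?_, ?_⟩⟩
  · intro k
    have := (hW 0).1 k
    have := h.zero k
    omega
  · exact fun i k => (H i k).2.1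
  · exact fun i k => (H i k).2.2.1
  · intro i k
    have := hMs i k
    have := (H i k).2.1
    omega
  · exact ⟨L, fun i hi k => congrFun (hlarge i hi) k⟩
  · exact fun i => (hW i).1
  · exact fun i => (hW i).2.1
  · exact fun i k => by rw [hM]; exact Nat.le_add_right _ _
  · exact fun i k => by rw [hM]; exact Nat.add_le_add_left (H i k).1 _
  · exact fun i k hk => by rw [hM, (H i k).2.2.2.2 hk, add_zero]

theorem IsPrehive.bound_unique {σ' : ℕ → ℕ} {M₂ : ℕ → ℕ → ℕ} (h : IsPrehive σ μ N M)
    (h₂ : IsPrehive σ' μ N M₂) : M = M₂ := by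
  funext i k
  induction k with
  | zero => rw [h.left, h₂.left]
  | succ k ih =>
    have := h.rel i k
    have := h₂.rel i k
    omega

/-- Rows are compared from the bottom up, each from left to right. At the first disagreement the
smaller of `N i k`, `N₂ i k` lies strictly below `N' i k`, so `slack` applies to both links and
equates the next row bounds; `rel` then contradicts the disagreement. -/
theorem IsLinked.left_unique {σ₂ : ℕ → ℕ} {N₂ M₂ : ℕ → ℕ → ℕ} (hl : IsLinked N M N' M')
    (hl₂ : IsLinked N₂ M₂ N' M') (h : IsHive σ μ ν N M) (h₂ : IsHive σ₂ μ ν N₂ M₂) :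
    N = N₂ ∧ M = M₂ := by
  obtain ⟨L, hL⟩ := h.content
  obtain ⟨L₂, hL₂⟩ := h₂.content
  have key : ∀ m i, max L L₂ ≤ i + m → ∀ k, N i k = N₂ i k := by
    intro m
    induction m with
    | zero => exact fun i hi k => by rw [hL i (by omega), hL₂ i (by omega)]
    | succ m ih =>
      intro i hi
      have ih' := ih (i + 1) (by omega)
      have hstep : ∀ k, M i k = M₂ i k → N i k = N₂ i k := by
        intro k hk
        have := ih' k
        have := ih' (k + 1)
        have := h.rel i k
        have := h₂.rel i k
        have := h.lat i k
        have := h₂.lat i k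
        have := hl.letter_le i k
        have := hl₂.letter_le i k
        have := hl.slack i k
        have := hl₂.slack i k
        omega
      have hM : ∀ k, M i k = M₂ i k := by
        intro k
        induction k with
        | zero => rw [h.left, h₂.left]
        | succ k ihk =>
          have := hstep k ihk
          have := ih' k
          have := h.rel i k
          have := h₂.rel i k
          omega
      exact fun k => hstep k (hM k)
  have hN : N = N₂ := funext fun i => funext (key (max L L₂) i (by omega))
  subst hN
  exact ⟨rfl, h.toIsPrehive.bound_unique h₂.toIsPrehive⟩

/-- The mirror image of `left_unique`: rows from the top down, each from right to left, starting
where both bounds equal `lam i`. Again `slack` excludes a disagreement. -/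
theorem IsLinked.right_unique {N₂ M₂ : ℕ → ℕ → ℕ} (hl : IsLinked N M N' M')
    (hl₂ : IsLinked N M N₂ M₂) (h : IsPrehive lam μ N' M') (h₂ : IsPrehive lam μ N₂ M₂) :
    N' = N₂ ∧ M' = M₂ := by
  have key : ∀ i k, N' i k = N₂ i k := by
    intro i
    induction i with
    | zero => exact fun k => by rw [h.zero, h₂.zero]
    | succ i ih =>
      have hstep : ∀ k, M' i (k + 1) = M₂ i (k + 1) → N' (i + 1) k = N₂ (i + 1) k := by
        intro k hk
        have := h.rel i k
        have := h₂.rel i k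
        have := ih k
        rcases k with _ | k
        · have := h.left i
          have := h₂.left i
          omega
        · have := ih k
          have := h.lat i k
          have := h₂.lat i k
          have := hl.letter_le (i + 1) (k + 1)
          have := hl₂.letter_le (i + 1) (k + 1)
          have := hl.slack i k
          have := hl₂.slack i k
          omega
      have hM : ∀ m k, i + 1 ≤ k + m → M' i k = M₂ i k := by
        intro m
        induction m with
        | zero =>
          intro k hk
          rw [h.eq_right_of_le (by omega), h₂.eq_right_of_le (by omega)]
        | succ m ihm =>
          intro k hk
          have h1 := ihm (k + 1) (by omega)
          have := hstep k h1
          have := ih k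
          have := h.rel i k
          have := h₂.rel i k
          omega
      exact fun k => hstep k (hM (i + 1) (k + 1) (by omega))
  have hN : N' = N₂ := funext fun i => funext (key i)
  subst hN
  exact ⟨rfl, h.bound_unique h₂⟩

/-- The Pieri rule for vertical strips, in terms of hives. -/
theorem card_hives_pieri (hlam : ∀ i, lam (i + 1) ≤ lam i) {n : ℕ} (hn : ∀ i, n ≤ i → lam i = 0)
    (hν : ∀ k, ν (k + 1) ≤ ν k) :
    Nat.card {p : (ℕ → ℕ → ℕ) × (ℕ → ℕ → ℕ) // IsHive (fun i => p.2 i (i + 1)) μ ν p.1 p.2 ∧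
      ∀ i, p.2 i (i + 1) ≤ lam i ∧ lam i ≤ p.2 i (i + 1) + 1} =
    Nat.card {q : (ℕ → ℕ → ℕ) × (ℕ → ℕ → ℕ) // IsPrehive lam μ q.1 q.2 ∧
      ∀ k, ν k ≤ q.1 n k ∧ q.1 n k ≤ ν k + 1} := by
  have hfwd : ∀ p : {p : (ℕ → ℕ → ℕ) × (ℕ → ℕ → ℕ) //
      IsHive (fun i => p.2 i (i + 1)) μ ν p.1 p.2 ∧
      ∀ i, p.2 i (i + 1) ≤ lam i ∧ lam i ≤ p.2 i (i + 1) + 1},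
      ∃ q : {q : (ℕ → ℕ → ℕ) × (ℕ → ℕ → ℕ) // IsPrehive lam μ q.1 q.2 ∧
        ∀ k, ν k ≤ q.1 n k ∧ q.1 n k ≤ ν k + 1},
        IsLinked p.1.1 p.1.2 q.1.1 q.1.2 := by
    rintro ⟨⟨N, M⟩, h, hs⟩
    obtain ⟨N', M', h', hl⟩ := h.toIsPrehive.exists_linked hlam (fun i => (hs i).1)
      (fun i => (hs i).2)
    refine ⟨⟨(N', M'), h', fun k => ?_⟩, hl⟩
    have := h.eq_content (n := n) (fun i hi => by
      have := hn i hi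
      have := (hs i).1
      dsimp only at *
      omega) le_rfl k
    rw [← this]
    exact ⟨hl.letter_le n k, hl.le_letter n k⟩
  choose f hf using hfwd
  -- Injectivity is `left_unique`; surjectivity is extraction together with `right_unique`.
  refine Nat.card_congr (Equiv.ofBijective f ⟨?_, ?_⟩)
  · rintro p p' hpp
    have h1 := hf p
    have h2 := hf p'
    rw [hpp] at h1
    have := h1.left_unique h2 p.2.1 p'.2.1
    exact Subtype.ext (Prod.ext this.1 this.2)
  · rintro ⟨⟨N', M'⟩, h', hq⟩
    obtain ⟨N, M, h, hl⟩ := h'.exists_linked_of_content hν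
      (fun i hi k => h'.eq_of_right_eq_zero hn hi k) (fun k => (hq k).1) (fun k => (hq k).2)
    have hs : ∀ i, M i (i + 1) ≤ lam i ∧ lam i ≤ M i (i + 1) + 1 := by
      intro i
      rw [← h'.right i]
      exact ⟨hl.bound_le i (i + 1), hl.le_bound i (i + 1)⟩
    refine ⟨⟨(N, M), h, hs⟩, ?_⟩
    have := (hf ⟨(N, M), h, hs⟩).right_unique hl (f _).2.1 h'
    exact Subtype.ext (Prod.ext this.1 this.2)

end


/-! ### Sizes, strips and the Pieri rule for coefficients. -/

/-- The Young diagram with prescribed row lengths. -/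
def ofRowFun (f : ℕ → ℕ) (hf : Antitone f) (n : ℕ) : YoungDiagram where
  cells := (Finset.range n ×ˢ Finset.range (f 0)).filter fun c => c.2 < f c.1
  isLowerSet := by
    rintro ⟨i, j⟩ ⟨i', j'⟩ ⟨hi, hj⟩ h
    simp only [Finset.coe_filter, Finset.mem_product, Finset.mem_range, Set.mem_ofPred_eq] at h ⊢
    have : f i ≤ f i' := hf hi
    dsimp only at hi hj h ⊢
    omega

theorem rowLen_ofRowFun {f : ℕ → ℕ} (hf : Antitone f) {n : ℕ} (hn : ∀ i, n ≤ i → f i = 0) (i : ℕ) :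
    (ofRowFun f hf n).rowLen i = f i := by
  refine eq_of_forall_lt_iff fun j => ?_
  rw [← mem_iff_lt_rowLen, ← mem_cells]
  simp only [ofRowFun, Finset.mem_filter, Finset.mem_product, Finset.mem_range]
  refine ⟨fun h => h.2, fun h => ⟨⟨?_, h.trans_le (hf (Nat.zero_le i))⟩, h⟩⟩
  by_contra hc
  have := hn i (by omega)
  omega

theorem card_eq_sum_rowLen (κ : YoungDiagram) {n : ℕ} (hn : κ.colLen 0 ≤ n) :
    κ.card = ∑ i ∈ Finset.range n, κ.rowLen i := by
  have hmaps : ∀ c ∈ κ.cells, c.1 ∈ Finset.range n := by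
    rintro ⟨i, j⟩ hc
    rw [Finset.mem_range]
    have := mem_iff_lt_colLen.1 (κ.up_left_mem le_rfl (Nat.zero_le j) hc)
    dsimp only
    omega
  rw [YoungDiagram.card, Finset.card_eq_sum_card_fiberwise hmaps]
  exact Finset.sum_congr rfl fun i _ => (κ.rowLen_eq_card).symm

theorem card_le_card {κ lam : YoungDiagram} (h : κ ≤ lam) : κ.card ≤ lam.card :=
  Finset.card_le_card (cells_subset_iff.2 h)

theorem eq_of_le_of_card_le {κ lam : YoungDiagram} (h : κ ≤ lam) (hc : lam.card ≤ κ.card) :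
    κ = lam :=
  YoungDiagram.ext (Finset.eq_of_subset_of_card_le (cells_subset_iff.2 h) hc)

theorem colLen_le_card (κ : YoungDiagram) (j : ℕ) : κ.colLen j ≤ κ.card := by
  rw [colLen_eq_card]
  exact Finset.card_filter_le _ _

theorem card_transpose (κ : YoungDiagram) : κ.transpose.card = κ.card := by
  simp [YoungDiagram.card, transpose]

theorem rowLen_le_card (κ : YoungDiagram) (i : ℕ) : κ.rowLen i ≤ κ.card := by
  rw [← colLen_transpose, ← card_transpose]
  exact colLen_le_card _ _

theorem IsLRTableau.card_add_card {lam μ ν : YoungDiagram} {T : ℕ → ℕ → ℕ}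
    (hT : IsLRTableau lam μ ν T) : μ.card + ν.card = lam.card := by
  have hmaps : ∀ c ∈ skewCells lam μ, T c.1 c.2 - 1 ∈ Finset.range (ν.colLen 0) := by
    rintro ⟨i, j⟩ hc
    have hp := hT.pos i j hc
    have h1 : 0 < ν.rowLen (T i j - 1) := by
      rw [← hT.content, Finset.card_pos]
      exact ⟨(i, j), Finset.mem_filter.2 ⟨hc, by dsimp only; omega⟩⟩
    exact Finset.mem_range.2 (mem_iff_lt_colLen.1 (mem_iff_lt_rowLen.2 h1))
  have hs : (skewCells lam μ).card = ν.card := by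
    rw [card_eq_sum_rowLen ν le_rfl, Finset.card_eq_sum_card_fiberwise hmaps]
    refine Finset.sum_congr rfl fun k _ => ?_
    rw [← hT.content]
    congr 1
    refine Finset.filter_congr fun c hc => ?_
    have := hT.pos c.1 c.2 hc
    omega
  rw [← hs, add_comm]
  exact Finset.card_sdiff_add_card_eq_card (cells_subset_iff.2 hT.le)

theorem lrCoeff_eq_zero_of_card_ne {lam μ ν : YoungDiagram} (h : μ.card + ν.card ≠ lam.card) :
    lrCoeff lam μ ν = 0 := by
  have : IsEmpty {T : ℕ → ℕ → ℕ // IsLRTableau lam μ ν T} := ⟨fun T => h T.2.card_add_card⟩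
  exact Nat.card_of_isEmpty

theorem lrCoeff_bot_of_ne {lam μ : YoungDiagram} (h : lam ≠ μ) : lrCoeff lam μ ⊥ = 0 := by
  have : IsEmpty {T : ℕ → ℕ → ℕ // IsLRTableau lam μ ⊥ T} :=
    ⟨fun T => h (eq_of_le_of_card_le T.2.le T.2.card_add_card.ge).symm⟩
  exact Nat.card_of_isEmpty

theorem lrCoeff_self_bot (μ : YoungDiagram) : lrCoeff μ μ ⊥ = 1 := by
  have hs : skewCells μ μ = ∅ := Finset.sdiff_self _
  have hw : ∀ T, reverseRowWord μ μ T = [] := by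
    intro T
    simp [reverseRowWord]
  have h0 : IsLRTableau μ μ ⊥ fun _ _ => 0 := by
    refine ⟨le_rfl, fun _ _ _ => rfl, ?_, ?_, ?_, ?_, ?_⟩
    · simp [hs]
    · simp [hs]
    · simp [hs]
    · intro k
      have : ¬ 0 < (⊥ : YoungDiagram).rowLen k :=
        fun h => notMem_bot _ (mem_iff_lt_rowLen.2 h)
      rw [hs, Finset.filter_empty, Finset.card_empty]
      omega
    · intro n i _
      simp [hw]
  rw [lrCoeff, Nat.card_eq_one_iff_unique]
  refine ⟨⟨?_⟩, ⟨⟨_, h0⟩⟩⟩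
  rintro ⟨T, hT⟩ ⟨S, hS⟩
  refine Subtype.ext (funext fun i => funext fun j => ?_)
  have hij : (i, j) ∉ skewCells μ μ := by simp [hs]
  exact (hT.zeros i j hij).trans (hS.zeros i j hij).symm

/-- `lam / σ` is a vertical strip. -/
def IsVerticalStrip (σ lam : YoungDiagram) : Prop :=
  ∀ i, σ.rowLen i ≤ lam.rowLen i ∧ lam.rowLen i ≤ σ.rowLen i + 1

/-- `lam / σ` is a horizontal strip. -/
def IsHorizontalStrip (σ lam : YoungDiagram) : Prop :=
  ∀ i, lam.rowLen (i + 1) ≤ σ.rowLen i ∧ σ.rowLen i ≤ lam.rowLen i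

/-- In terms of boxes the two kinds of strips are visibly exchanged by transposition. -/
theorem isVerticalStrip_iff {σ lam : YoungDiagram} :
    IsVerticalStrip σ lam ↔ σ ≤ lam ∧ ∀ i j, (i, j + 1) ∈ lam → (i, j) ∈ σ := by
  simp only [mem_iff_lt_rowLen, le_iff_rowLen, IsVerticalStrip, forall_and]
  refine and_congr_right fun _ => forall_congr' fun i => ⟨fun h j hj => by omega, fun h => ?_⟩
  by_contra hc
  have := h (σ.rowLen i) (by omega)
  omega

theorem isHorizontalStrip_iff {σ lam : YoungDiagram} :
    IsHorizontalStrip σ lam ↔ σ ≤ lam ∧ ∀ i j, (i + 1, j) ∈ lam → (i, j) ∈ σ := by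
  simp only [mem_iff_lt_rowLen, le_iff_rowLen, IsHorizontalStrip, forall_and]
  rw [and_comm]
  refine and_congr_right fun _ => forall_congr' fun i => ⟨fun h j hj => by omega, fun h => ?_⟩
  exact le_of_forall_lt h

theorem isHorizontalStrip_transpose {σ lam : YoungDiagram} :
    IsHorizontalStrip σ.transpose lam.transpose ↔ IsVerticalStrip σ lam := by
  rw [isHorizontalStrip_iff, isVerticalStrip_iff, transpose_le_iff, forall_comm]
  simp only [mem_transpose, Prod.swap_prod_mk]

theorem IsVerticalStrip.le {σ lam : YoungDiagram} (h : IsVerticalStrip σ lam) : σ ≤ lam :=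
  (isVerticalStrip_iff.1 h).1

theorem IsHorizontalStrip.le {σ lam : YoungDiagram} (h : IsHorizontalStrip σ lam) : σ ≤ lam :=
  (isHorizontalStrip_iff.1 h).1

theorem isVerticalStrip_refl (σ : YoungDiagram) : IsVerticalStrip σ σ := fun _ => by omega

theorem isHorizontalStrip_refl (σ : YoungDiagram) : IsHorizontalStrip σ σ :=
  fun i => ⟨σ.rowLen_anti i (i + 1) (Nat.le_succ i), le_rfl⟩

/-- The Young diagrams with at most `n` boxes. -/
abbrev BoundedDiagram (n : ℕ) : Type := {κ : YoungDiagram // κ.card ≤ n}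

instance (n : ℕ) : Finite (BoundedDiagram n) := by
  refine Finite.of_injective (β := ((Finset.range n ×ˢ Finset.range n).powerset))
    (fun κ => ⟨κ.1.cells, ?_⟩) ?_
  · rw [Finset.mem_powerset]
    rintro ⟨i, j⟩ hc
    have h1 := mem_iff_lt_colLen.1 ((mem_cells _).1 hc)
    have h2 := mem_iff_lt_rowLen.1 ((mem_cells _).1 hc)
    have := κ.2
    have := colLen_le_card κ.1 j
    have := rowLen_le_card κ.1 i
    rw [Finset.mem_product, Finset.mem_range, Finset.mem_range]
    dsimp only
    omega
  · intro κ κ' h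
    exact Subtype.ext (YoungDiagram.ext (congrArg Subtype.val h))

noncomputable instance (n : ℕ) : Fintype (BoundedDiagram n) := Fintype.ofFinite _

noncomputable instance (n : ℕ) : DecidableEq (BoundedDiagram n) := Classical.decEq _

open Classical in
-- The intermediate shape `σ` is recovered from the arrays as `M i (i + 1)`, so the disjoint union
-- over `σ` is a single set of arrays.
theorem sum_lrCoeff_shape {lam : YoungDiagram} (μ ν : YoungDiagram) {n : ℕ} (hn : lam.card ≤ n) :
    ∑ σ : BoundedDiagram n, (if IsVerticalStrip σ.1 lam then lrCoeff σ.1 μ ν else 0) =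
    Nat.card {p : (ℕ → ℕ → ℕ) × (ℕ → ℕ → ℕ) //
      IsHive (fun i => p.2 i (i + 1)) μ.rowLen ν.rowLen p.1 p.2 ∧
      ∀ i, p.2 i (i + 1) ≤ lam.rowLen i ∧ lam.rowLen i ≤ p.2 i (i + 1) + 1} := by
  have hfin : ∀ σ : BoundedDiagram n, Finite {p : (ℕ → ℕ → ℕ) × (ℕ → ℕ → ℕ) //
      IsHive σ.1.rowLen μ.rowLen ν.rowLen p.1 p.2 ∧ IsVerticalStrip σ.1 lam} := fun σ =>
    have := finite_hives σ.1 μ ν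
    Finite.of_injective (fun p => (⟨p.1, p.2.1⟩ : {p : (ℕ → ℕ → ℕ) × (ℕ → ℕ → ℕ) //
      IsHive σ.1.rowLen μ.rowLen ν.rowLen p.1 p.2}))
      fun p q h => Subtype.ext (congrArg (fun x => x.1) h)
  have hcard : ∀ σ : BoundedDiagram n, (if IsVerticalStrip σ.1 lam then lrCoeff σ.1 μ ν else 0) =
      Nat.card {p : (ℕ → ℕ → ℕ) × (ℕ → ℕ → ℕ) //
        IsHive σ.1.rowLen μ.rowLen ν.rowLen p.1 p.2 ∧ IsVerticalStrip σ.1 lam} := by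
    intro σ
    split_ifs with h
    · simp only [h, and_true]
      exact lrCoeff_eq_card_hives σ.1 μ ν
    · simp [h]
  rw [Finset.sum_congr rfl fun σ _ => hcard σ, ← Nat.card_sigma]
  refine Nat.card_congr (Equiv.ofBijective (fun x => ⟨x.2.1, ?_, ?_⟩) ⟨?_, ?_⟩)
  · rw [funext x.2.2.1.right]
    exact x.2.2.1
  · intro i
    rw [x.2.2.1.right]
    exact x.2.2.2 i
  · rintro ⟨σ, p, h, hv⟩ ⟨σ', p', h', hv'⟩ heq
    obtain rfl : p = p' := congrArg (fun x => x.1) heq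
    obtain rfl : σ = σ' := Subtype.ext (ext_rowLen fun i => by rw [← h.right, ← h'.right])
    rfl
  · rintro ⟨p, h, hs⟩
    have hz : ∀ i, lam.colLen 0 ≤ i → p.2 i (i + 1) = 0 := by
      intro i hi
      have := rowLen_eq_zero hi
      have := (hs i).1
      omega
    let σ := ofRowFun (fun i => p.2 i (i + 1)) (antitone_nat_of_succ_le h.right_anti)
      (lam.colLen 0)
    have hσ : ∀ i, σ.rowLen i = p.2 i (i + 1) :=
      rowLen_ofRowFun (antitone_nat_of_succ_le h.right_anti) hz
    have hv : IsVerticalStrip σ lam := fun i => by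
      rw [hσ]
      exact hs i
    refine ⟨⟨⟨σ, (card_le_card hv.le).trans hn⟩, p, ?_, hv⟩, rfl⟩
    dsimp only
    rw [funext hσ]
    exact h

open Classical in
-- Likewise the content `τ` is the row `lam.colLen 0` of `N`.
theorem sum_lrCoeff_content {lam : YoungDiagram} (μ ν : YoungDiagram) {n : ℕ} (hn : lam.card ≤ n) :
    ∑ τ : BoundedDiagram n, (if IsVerticalStrip ν τ.1 then lrCoeff lam μ τ.1 else 0) =
    Nat.card {q : (ℕ → ℕ → ℕ) × (ℕ → ℕ → ℕ) // IsPrehive lam.rowLen μ.rowLen q.1 q.2 ∧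
      ∀ k, ν.rowLen k ≤ q.1 (lam.colLen 0) k ∧ q.1 (lam.colLen 0) k ≤ ν.rowLen k + 1} := by
  have hfin : ∀ τ : BoundedDiagram n, Finite {p : (ℕ → ℕ → ℕ) × (ℕ → ℕ → ℕ) //
      IsHive lam.rowLen μ.rowLen τ.1.rowLen p.1 p.2 ∧ IsVerticalStrip ν τ.1} := fun τ =>
    have := finite_hives lam μ τ.1
    Finite.of_injective (fun p => (⟨p.1, p.2.1⟩ : {p : (ℕ → ℕ → ℕ) × (ℕ → ℕ → ℕ) //
      IsHive lam.rowLen μ.rowLen τ.1.rowLen p.1 p.2}))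
      fun p q h => Subtype.ext (congrArg (fun x => x.1) h)
  have hcard : ∀ τ : BoundedDiagram n, (if IsVerticalStrip ν τ.1 then lrCoeff lam μ τ.1 else 0) =
      Nat.card {p : (ℕ → ℕ → ℕ) × (ℕ → ℕ → ℕ) //
        IsHive lam.rowLen μ.rowLen τ.1.rowLen p.1 p.2 ∧ IsVerticalStrip ν τ.1} := by
    intro τ
    split_ifs with h
    · simp only [h, and_true]
      exact lrCoeff_eq_card_hives lam μ τ.1
    · simp [h]
  have hcont : ∀ {τ : ℕ → ℕ} {N M : ℕ → ℕ → ℕ}, IsHive lam.rowLen μ.rowLen τ N M →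
      ∀ k, N (lam.colLen 0) k = τ k :=
    fun h k => h.eq_content (fun i hi => rowLen_eq_zero hi) le_rfl k
  rw [Finset.sum_congr rfl fun τ _ => hcard τ, ← Nat.card_sigma]
  refine Nat.card_congr (Equiv.ofBijective (fun x => ⟨x.2.1, x.2.2.1.toIsPrehive, ?_⟩) ⟨?_, ?_⟩)
  · intro k
    rw [hcont x.2.2.1]
    exact x.2.2.2 k
  · rintro ⟨τ, p, h, hv⟩ ⟨τ', p', h', hv'⟩ heq
    obtain rfl : p = p' := congrArg (fun x => x.1) heq
    obtain rfl : τ = τ' := Subtype.ext (ext_rowLen fun k => by rw [← hcont h, ← hcont h'])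
    rfl
  · rintro ⟨p, h, hs⟩
    have ha : Antitone (p.1 (lam.colLen 0)) :=
      antitone_nat_of_succ_le (h.letter_anti (lam.colLen 0))
    let τ := ofRowFun (p.1 (lam.colLen 0)) ha (lam.colLen 0)
    have hτ : ∀ k, τ.rowLen k = p.1 (lam.colLen 0) k :=
      rowLen_ofRowFun ha fun k hk => h.eq_zero_of_le hk
    have hh : IsHive lam.rowLen μ.rowLen τ.rowLen p.1 p.2 :=
      ⟨h, lam.colLen 0, fun i hi k => by
        rw [hτ]
        exact h.eq_of_right_eq_zero (fun i hi => rowLen_eq_zero hi) hi k⟩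
    have hc := hh.isLRTableau.card_add_card
    refine ⟨⟨⟨τ, by omega⟩, p, hh, fun k => ?_⟩, rfl⟩
    rw [hτ]
    exact hs k

open Classical in
/-- The Pieri rule for vertical strips. -/
theorem sum_lrCoeff_pieri {lam : YoungDiagram} (μ ν : YoungDiagram) {n : ℕ} (hn : lam.card ≤ n) :
    ∑ σ : BoundedDiagram n, (if IsVerticalStrip σ.1 lam then lrCoeff σ.1 μ ν else 0) =
    ∑ τ : BoundedDiagram n, (if IsVerticalStrip ν τ.1 then lrCoeff lam μ τ.1 else 0) := by
  rw [sum_lrCoeff_shape μ ν hn, sum_lrCoeff_content μ ν hn]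
  exact card_hives_pieri (fun i => lam.rowLen_anti i (i + 1) (Nat.le_succ i))
    (fun i hi => rowLen_eq_zero hi) (fun k => ν.rowLen_anti k (k + 1) (Nat.le_succ k))


/-! ### Transfer matrices of strips. -/

open Classical in
/-- The transfer matrix of vertical strips. -/
noncomputable def verticalMatrix (n : ℕ) : Matrix (BoundedDiagram n) (BoundedDiagram n) ℤ :=
  Matrix.of fun σ lam => if IsVerticalStrip σ.1 lam.1 then 1 else 0

open Classical in
/-- The transfer matrix of horizontal strips. -/
noncomputable def horizontalMatrix (n : ℕ) : Matrix (BoundedDiagram n) (BoundedDiagram n) ℤ :=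
  Matrix.of fun σ lam => if IsHorizontalStrip σ.1 lam.1 then 1 else 0

/-- The matrix of horizontal strips, signed by the parity of their size. -/
noncomputable def signedHorizontalMatrix (n : ℕ) :
    Matrix (BoundedDiagram n) (BoundedDiagram n) ℤ :=
  Matrix.of fun σ lam => (-1) ^ (σ.1.card + lam.1.card) * horizontalMatrix n σ lam

/-- The matrix of Littlewood-Richardson coefficients with a fixed inner shape. -/
noncomputable def lrMatrix (n : ℕ) (μ : YoungDiagram) :
    Matrix (BoundedDiagram n) (BoundedDiagram n) ℤ :=
  Matrix.of fun ν lam => (lrCoeff lam.1 μ ν.1 : ℤ)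

theorem lrMatrix_mul_verticalMatrix (n : ℕ) (μ : YoungDiagram) :
    lrMatrix n μ * verticalMatrix n = verticalMatrix n * lrMatrix n μ := by
  classical
  ext ν lam
  have h := sum_lrCoeff_pieri μ ν.1 lam.2
  simp only [Matrix.mul_apply, lrMatrix, verticalMatrix, Matrix.of_apply, mul_ite, ite_mul, mul_one,
    one_mul, mul_zero, zero_mul]
  exact_mod_cast h

/-- Changing the length of row `r` of `σ` to the other element of `{ν.rowLen r, ν.rowLen r + 1}`
when `r` is the last nonempty row of `lam / ν`. -/
theorem exists_toggle {ν lam σ : YoungDiagram} {r : ℕ} (hr : ν.rowLen r < lam.rowLen r)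
    (hlast : ∀ i, r < i → lam.rowLen i ≤ ν.rowLen i) (hv : IsVerticalStrip ν σ)
    (hh : IsHorizontalStrip σ lam) :
    ∃ σ' : YoungDiagram, IsVerticalStrip ν σ' ∧ IsHorizontalStrip σ' lam ∧
      ∀ i, σ'.rowLen i = if i = r then 2 * ν.rowLen r + 1 - σ.rowLen r else σ.rowLen i := by
  let f : ℕ → ℕ := fun i => if i = r then 2 * ν.rowLen r + 1 - σ.rowLen r else σ.rowLen i
  have hf : ∀ i, ν.rowLen i ≤ f i ∧ f i ≤ ν.rowLen i + 1 ∧ lam.rowLen (i + 1) ≤ f i ∧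
      f i ≤ lam.rowLen i := by
    intro i
    have h1 := hv i
    have h2 := hh i
    by_cases hi : i = r
    · subst hi
      simp only [f, if_true]
      -- Both lengths `ν.rowLen r` and `ν.rowLen r + 1` are admissible: row `r + 1` of `lam` is no
      -- longer than that of `ν`, and row `r` of `lam` is longer than that of `ν`.
      have h3 := hlast (i + 1) (Nat.lt_succ_self i)
      have h4 := ν.rowLen_anti i (i + 1) (Nat.le_succ i)
      omega
    · simp only [f, if_neg hi]
      omega
  have ha : Antitone f := antitone_nat_of_succ_le fun i => (hf (i + 1)).2.2.2.trans (hf i).2.2.1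
  have hrow : ∀ i, (ofRowFun f ha (lam.colLen 0)).rowLen i = f i :=
    rowLen_ofRowFun ha fun i hi => by
      have := (hf i).2.2.2
      rw [rowLen_eq_zero hi] at this
      omega
  refine ⟨ofRowFun f ha (lam.colLen 0), fun i => ?_, fun i => ?_, hrow⟩
  · rw [hrow]
    exact ⟨(hf i).1, (hf i).2.1⟩
  · rw [hrow]
    exact (hf i).2.2

/-- The analogue of E(t)H(-t) = 1. Off the diagonal the terms cancel under the involution that
toggles the last nonempty row of `lam / ν`, which changes the size of `σ` by one. -/
theorem verticalMatrix_mul_signedHorizontalMatrix (n : ℕ) :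
    verticalMatrix n * signedHorizontalMatrix n = 1 := by
  classical
  ext ν lam
  have hterm : ∀ σ : BoundedDiagram n, verticalMatrix n ν σ * signedHorizontalMatrix n σ lam =
      if IsVerticalStrip ν.1 σ.1 ∧ IsHorizontalStrip σ.1 lam.1 then
        (-1) ^ (σ.1.card + lam.1.card) else 0 := by
    intro σ
    simp only [verticalMatrix, signedHorizontalMatrix, horizontalMatrix, Matrix.of_apply]
    split_ifs <;> simp_all
  rw [Matrix.mul_apply, Finset.sum_congr rfl fun σ _ => hterm σ, ← Finset.sum_filter]
  by_cases hle : ν.1 ≤ lam.1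
  swap
  · rw [Finset.filter_false_of_mem, Finset.sum_empty, Matrix.one_apply_ne]
    · rintro rfl
      exact hle le_rfl
    · exact fun σ _ h => hle (h.1.le.trans h.2.le)
  by_cases heq : ν = lam
  · subst heq
    have : (Finset.univ.filter fun σ : BoundedDiagram n =>
        IsVerticalStrip ν.1 σ.1 ∧ IsHorizontalStrip σ.1 ν.1) = {ν} := by
      ext σ
      simp only [Finset.mem_filter, Finset.mem_univ, true_and, Finset.mem_singleton]
      constructor
      · exact fun h => Subtype.ext (le_antisymm h.2.le h.1.le)
      · rintro rfl
        exact ⟨isVerticalStrip_refl _, isHorizontalStrip_refl _⟩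
    rw [this, Finset.sum_singleton, Matrix.one_apply_eq, ← two_mul, pow_mul]
    simp
  rw [Matrix.one_apply_ne heq]
  obtain ⟨r, hr, hlast⟩ : ∃ r, ν.1.rowLen r < lam.1.rowLen r ∧
      ∀ i, r < i → lam.1.rowLen i ≤ ν.1.rowLen i := by
    let S := (Finset.range (lam.1.colLen 0)).filter fun i => ν.1.rowLen i < lam.1.rowLen i
    have hmem : ∀ i, ν.1.rowLen i < lam.1.rowLen i → i ∈ S := by
      intro i hi
      rw [Finset.mem_filter, Finset.mem_range]
      refine ⟨?_, hi⟩
      by_contra hc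
      have := rowLen_eq_zero (not_lt.1 hc)
      omega
    have hS : S.Nonempty := by
      by_contra hS
      rw [Finset.not_nonempty_iff_eq_empty] at hS
      refine heq (Subtype.ext (le_antisymm hle (le_iff_rowLen.2 fun i => ?_)))
      by_contra hc
      have := hmem i (not_le.1 hc)
      rw [hS] at this
      exact Finset.notMem_empty i this
    refine ⟨S.max' hS, (Finset.mem_filter.1 (S.max'_mem hS)).2, fun i hi => ?_⟩
    by_contra hc
    have := S.le_max' i (hmem i (not_le.1 hc))
    omega
  have hrlt : r < lam.1.colLen 0 := by
    by_contra hc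
    have := rowLen_eq_zero (not_lt.1 hc)
    omega
  have htog : ∀ σ : BoundedDiagram n, IsVerticalStrip ν.1 σ.1 ∧ IsHorizontalStrip σ.1 lam.1 →
      ∃ σ' : BoundedDiagram n, (IsVerticalStrip ν.1 σ'.1 ∧ IsHorizontalStrip σ'.1 lam.1) ∧
        ∀ i, σ'.1.rowLen i =
          if i = r then 2 * ν.1.rowLen r + 1 - σ.1.rowLen r else σ.1.rowLen i := by
    intro σ h
    obtain ⟨σ', h1, h2, h3⟩ := exists_toggle hr hlast h.1 h.2
    exact ⟨⟨σ', (card_le_card h2.le).trans lam.2⟩, ⟨h1, h2⟩, h3⟩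
  choose! g hg hgrow using htog
  have hcard : ∀ σ : BoundedDiagram n, IsVerticalStrip ν.1 σ.1 ∧ IsHorizontalStrip σ.1 lam.1 →
      ∃ m, σ.1.card + (g σ).1.card = 2 * m + 1 := by
    intro σ h
    have hcol : ∀ κ : YoungDiagram, κ ≤ lam.1 → κ.colLen 0 ≤ lam.1.colLen 0 := by
      intro κ hκ
      by_contra hc
      have := mem_iff_lt_colLen.1 (hκ (mem_iff_lt_colLen.2 (not_le.1 hc)))
      omega
    rw [card_eq_sum_rowLen _ (hcol _ h.2.le), card_eq_sum_rowLen _ (hcol _ (hg σ h).2.le),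
      ← Finset.add_sum_erase _ _ (Finset.mem_range.2 hrlt),
      ← Finset.add_sum_erase _ (fun i => (g σ).1.rowLen i) (Finset.mem_range.2 hrlt)]
    have hrest : ∑ i ∈ (Finset.range (lam.1.colLen 0)).erase r, (g σ).1.rowLen i =
        ∑ i ∈ (Finset.range (lam.1.colLen 0)).erase r, σ.1.rowLen i :=
      Finset.sum_congr rfl fun i hi => by rw [hgrow σ h, if_neg (Finset.ne_of_mem_erase hi)]
    rw [hrest, hgrow σ h, if_pos rfl]
    have := h.1 r
    exact ⟨ν.1.rowLen r + ∑ i ∈ (Finset.range (lam.1.colLen 0)).erase r, σ.1.rowLen i, by omega⟩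
  refine Finset.sum_involution (fun σ _ => g σ) ?_ ?_ ?_ ?_
  · intro σ hσ
    obtain ⟨m, hm⟩ := hcard σ (Finset.mem_filter.1 hσ).2
    have : (-1 : ℤ) ^ (σ.1.card + lam.1.card) * (-1) ^ ((g σ).1.card + lam.1.card) = -1 := by
      rw [← pow_add, show σ.1.card + lam.1.card + ((g σ).1.card + lam.1.card) =
        2 * (m + lam.1.card) + 1 by omega, pow_succ, pow_mul]
      simp
    rcases neg_one_pow_eq_or ℤ (σ.1.card + lam.1.card) with h | h <;> rw [h] at this ⊢ <;> omega
  · intro σ hσ _ hc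
    obtain ⟨m, hm⟩ := hcard σ (Finset.mem_filter.1 hσ).2
    rw [hc] at hm
    omega
  · intro σ hσ
    exact Finset.mem_filter.2 ⟨Finset.mem_univ _, hg σ (Finset.mem_filter.1 hσ).2⟩
  · intro σ hσ
    have h := (Finset.mem_filter.1 hσ).2
    refine Subtype.ext (ext_rowLen fun i => ?_)
    rw [hgrow _ (hg σ h), hgrow σ h, hgrow σ h, if_pos rfl]
    have := h.1 r
    by_cases hi : i = r
    · subst hi
      rw [if_pos rfl]
      omega
    · rw [if_neg hi, if_neg hi]

theorem lrMatrix_eq_zero {n : ℕ} {μ : YoungDiagram} {ν lam : BoundedDiagram n}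
    (h : μ.card + ν.1.card ≠ lam.1.card) : lrMatrix n μ ν lam = 0 := by
  rw [lrMatrix, Matrix.of_apply, lrCoeff_eq_zero_of_card_ne h, Nat.cast_zero]

/-- Commuting with an invertible matrix implies commuting with its inverse, the signed matrix. The
signs then drop out, because the coefficients vanish unless sizes add up, which makes the sign the
same for all nonzero terms on both sides. -/
theorem lrMatrix_mul_horizontalMatrix (n : ℕ) (μ : YoungDiagram) :
    lrMatrix n μ * horizontalMatrix n = horizontalMatrix n * lrMatrix n μ := by
  have hinv := verticalMatrix_mul_signedHorizontalMatrix n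
  have hinv' := mul_eq_one_comm.1 hinv
  have hcomm : lrMatrix n μ * signedHorizontalMatrix n =
      signedHorizontalMatrix n * lrMatrix n μ := by
    calc lrMatrix n μ * signedHorizontalMatrix n
        = signedHorizontalMatrix n * (verticalMatrix n * lrMatrix n μ) *
            signedHorizontalMatrix n := by rw [← Matrix.mul_assoc, hinv', Matrix.one_mul]
      _ = signedHorizontalMatrix n * lrMatrix n μ *
            (verticalMatrix n * signedHorizontalMatrix n) := by
          rw [← lrMatrix_mul_verticalMatrix]
          simp only [Matrix.mul_assoc]
      _ = _ := by rw [hinv, Matrix.mul_one]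
  ext ν lam
  have hsq : ∀ m : ℕ, ((-1 : ℤ) ^ m) * (-1) ^ m = 1 := fun m => by
    rw [← pow_add, ← two_mul, pow_mul]
    simp
  have h := congrFun (congrFun hcomm ν) lam
  rw [Matrix.mul_apply, Matrix.mul_apply] at h ⊢
  have h1 : ∑ σ, lrMatrix n μ ν σ * signedHorizontalMatrix n σ lam =
      (-1) ^ (μ.card + ν.1.card + lam.1.card) *
        ∑ σ, lrMatrix n μ ν σ * horizontalMatrix n σ lam := by
    rw [Finset.mul_sum]
    refine Finset.sum_congr rfl fun σ _ => ?_
    by_cases hc : μ.card + ν.1.card = σ.1.card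
    · rw [signedHorizontalMatrix, Matrix.of_apply, hc]
      ring
    · rw [lrMatrix_eq_zero hc]
      ring
  have h2 : ∑ τ, signedHorizontalMatrix n ν τ * lrMatrix n μ τ lam =
      (-1) ^ (μ.card + ν.1.card + lam.1.card) *
        ∑ τ, horizontalMatrix n ν τ * lrMatrix n μ τ lam := by
    rw [Finset.mul_sum]
    refine Finset.sum_congr rfl fun τ _ => ?_
    by_cases hc : μ.card + τ.1.card = lam.1.card
    · rw [signedHorizontalMatrix, Matrix.of_apply, ← hc,
        show μ.card + ν.1.card + (μ.card + τ.1.card) = 2 * μ.card + (ν.1.card + τ.1.card) by ring,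
        pow_add _ (2 * μ.card), pow_mul]
      simp
      ring
    · rw [lrMatrix_eq_zero hc]
      ring
  rw [h1, h2] at h
  exact mul_left_cancel₀ (pow_ne_zero _ (by norm_num)) h

/-- Conjugation of Young diagrams of bounded size. -/
def transposeEquiv (n : ℕ) : BoundedDiagram n ≃ BoundedDiagram n where
  toFun κ := ⟨κ.1.transpose, (card_transpose κ.1).trans_le κ.2⟩
  invFun κ := ⟨κ.1.transpose, (card_transpose κ.1).trans_le κ.2⟩
  left_inv κ := Subtype.ext (transpose_transpose κ.1)
  right_inv κ := Subtype.ext (transpose_transpose κ.1)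

theorem horizontalMatrix_submatrix (n : ℕ) :
    (horizontalMatrix n).submatrix (transposeEquiv n) (transposeEquiv n) = verticalMatrix n := by
  classical
  ext σ lam
  simp only [Matrix.submatrix_apply, horizontalMatrix, verticalMatrix, Matrix.of_apply]
  exact if_congr isHorizontalStrip_transpose rfl rfl

theorem lrMatrix_submatrix_mul_verticalMatrix (n : ℕ) (μ : YoungDiagram) :
    (lrMatrix n μ).submatrix (transposeEquiv n) (transposeEquiv n) * verticalMatrix n =
      verticalMatrix n * (lrMatrix n μ).submatrix (transposeEquiv n) (transposeEquiv n) := by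
  rw [← horizontalMatrix_submatrix, Matrix.submatrix_mul_equiv, Matrix.submatrix_mul_equiv,
    lrMatrix_mul_horizontalMatrix]

/-! ### Uniqueness and conjugation symmetry. -/

theorem exists_removeColumn (ν : YoungDiagram) :
    ∃ ρ : YoungDiagram, ∀ i, ρ.rowLen i = ν.rowLen i - 1 := by
  have ha : Antitone fun i => ν.rowLen i - 1 := fun i j hij =>
    Nat.sub_le_sub_right (ν.rowLen_anti i j hij) 1
  exact ⟨ofRowFun _ ha (ν.colLen 0), rowLen_ofRowFun ha fun i hi => by rw [rowLen_eq_zero hi]⟩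

/-- Commuting with the matrix of vertical strips determines a matrix of the degree of `lrMatrix`
from its row at the empty diagram. -/
theorem eq_zero_of_mul_verticalMatrix {n m : ℕ}
    {D : Matrix (BoundedDiagram n) (BoundedDiagram n) ℤ}
    (hcomm : D * verticalMatrix n = verticalMatrix n * D)
    (hdeg : ∀ ν lam, m + ν.1.card ≠ lam.1.card → D ν lam = 0)
    (hbot : ∀ ν lam, ν.1 = ⊥ → D ν lam = 0) : D = 0 := by
  -- Induction on the size of `ν`, then on the number of its boxes outside the first column. The
  -- commutation relation is read in row `ρ`, which is `ν` without its first column: one side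
  -- vanishes because `ρ` is smaller, and on the other only `τ = ν` survives.
  have key : ∀ d e, ∀ ν lam : BoundedDiagram n, ν.1.card = d → ν.1.card - ν.1.colLen 0 = e →
      D ν lam = 0 := by
    intro d
    induction d using Nat.strong_induction_on with
    | _ d ihd =>
    intro e
    induction e using Nat.strong_induction_on with
    | _ e ihe =>
    intro ν lam hd he
    by_cases hν : ν.1 = ⊥
    · exact hbot ν lam hν
    by_cases hm : m + ν.1.card = lam.1.card
    swap
    · exact hdeg ν lam hm
    obtain ⟨ρ, hρ⟩ := exists_removeColumn ν.1
    have hρν : ρ ≤ ν.1 := le_iff_rowLen.2 fun i => by rw [hρ]; omega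
    have hlt : ρ.card < d := by
      rw [← hd]
      refine lt_of_le_of_ne (card_le_card hρν) fun hc => hν ?_
      have heq := eq_of_le_of_card_le hρν hc.ge
      refine eq_bot_iff.2 (le_iff_rowLen.2 fun i => ?_)
      have := hρ i
      rw [heq] at this
      omega
    have h := congrFun (congrFun hcomm ⟨ρ, (card_le_card hρν).trans ν.2⟩) lam
    rw [Matrix.mul_apply, Matrix.mul_apply, Finset.sum_eq_zero, Finset.sum_eq_single ν] at h
    · have hv : IsVerticalStrip ρ ν.1 := fun i => by rw [hρ]; omega
      simpa [verticalMatrix, hv] using h.symm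
    · intro τ _ hτ
      by_cases hv : IsVerticalStrip ρ τ.1
      swap
      · simp [verticalMatrix, hv]
      by_cases hmτ : m + τ.1.card = lam.1.card
      swap
      · rw [hdeg τ lam hmτ, mul_zero]
      -- If `τ` had no more rows than `ν`, then `τ ≤ ν`, since each row of `τ` exceeds that of `ρ`
      -- by at most one; equal size would give `τ = ν`.
      have hlen : ν.1.colLen 0 < τ.1.colLen 0 := by
        by_contra hc
        refine hτ (Subtype.ext (eq_of_le_of_card_le (le_iff_rowLen.2 fun i => ?_) (by omega)))
        have h1 := (hv i).2
        rw [hρ] at h1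
        by_cases hi : i < ν.1.colLen 0
        · have := mem_iff_lt_rowLen.1 (mem_iff_lt_colLen.2 hi)
          omega
        · rw [rowLen_eq_zero (by omega)]
          exact Nat.zero_le _
      have := colLen_le_card τ.1 0
      rw [ihe (τ.1.card - τ.1.colLen 0) (by omega) τ lam (by omega) rfl, mul_zero]
    · exact fun hc => absurd (Finset.mem_univ ν) hc
    · intro σ _
      rw [ihd ρ.card hlt _ _ σ rfl rfl, zero_mul]
  ext ν lam
  exact key _ _ ν lam rfl rfl

/-- Conjugation symmetry of Littlewood-Richardson coefficients. -/
theorem lrCoeff_transpose (lam μ ν : YoungDiagram) :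
    lrCoeff lam.transpose μ.transpose ν.transpose = lrCoeff lam μ ν := by
  let n := lam.card + ν.card
  let D : Matrix (BoundedDiagram n) (BoundedDiagram n) ℤ :=
    (lrMatrix n μ.transpose).submatrix (transposeEquiv n) (transposeEquiv n) - lrMatrix n μ
  have happ : ∀ κ σ, D κ σ = (lrCoeff σ.1.transpose μ.transpose κ.1.transpose : ℤ) -
      lrCoeff σ.1 μ κ.1 := fun _ _ => rfl
  have hD : D = 0 := by
    refine eq_zero_of_mul_verticalMatrix (m := μ.card) ?_ ?_ ?_
    · rw [Matrix.sub_mul, Matrix.mul_sub, lrMatrix_submatrix_mul_verticalMatrix,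
        lrMatrix_mul_verticalMatrix]
    · intro κ σ h
      rw [happ, lrCoeff_eq_zero_of_card_ne h, lrCoeff_eq_zero_of_card_ne, sub_self]
      rwa [card_transpose, card_transpose, card_transpose]
    · intro κ σ h
      have hb : (⊥ : YoungDiagram).transpose = ⊥ := transposeOrderIso.map_bot
      rw [happ, h, hb]
      by_cases hσ : σ.1 = μ
      · rw [hσ, lrCoeff_self_bot, lrCoeff_self_bot, sub_self]
      · rw [lrCoeff_bot_of_ne hσ, lrCoeff_bot_of_ne fun hc => hσ (transpose_eq_iff.1 hc), sub_self]
  have h := happ ⟨ν, Nat.le_add_left _ _⟩ ⟨lam, Nat.le_add_right _ _⟩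
  rw [hD, Matrix.zero_apply] at h
  exact_mod_cast (sub_eq_zero.1 h.symm)

/-! ### The second inequality: inserting a part. -/

theorem lt_countP_iff_of_pairwise {w : List ℕ} (hw : w.Pairwise (· ≥ ·)) (i j : ℕ) :
    i < w.countP (j < ·) ↔ ∃ h : i < w.length, j < w[i] := by
  induction w generalizing i with
  | nil => simp
  | cons x l ih =>
    rw [List.pairwise_cons] at hw
    by_cases hx : j < x
    · rw [List.countP_cons_of_pos (by simpa using hx)]
      rcases i with _ | i
      · simp [hx]
      · simpa using ih hw.2 i
    · have hle : ∀ y ∈ x :: l, y ≤ j := by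
        intro y hy
        rcases List.mem_cons.1 hy with rfl | hy
        · omega
        · have := hw.1 y hy
          omega
      rw [List.countP_eq_zero.2 fun y hy => by simpa using hle y hy]
      refine iff_of_false (Nat.not_lt_zero i) ?_
      rintro ⟨h, h'⟩
      have := hle _ (List.getElem_mem h)
      omega

theorem colLen_ofRowLens {w : List ℕ} (hw : w.SortedGE) (j : ℕ) :
    (ofRowLens w hw).colLen j = w.countP (j < ·) := by
  refine eq_of_forall_lt_iff fun i => ?_
  rw [← mem_iff_lt_colLen, mem_ofRowLens, lt_countP_iff_of_pairwise hw.pairwise]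

/-- Column `j` has as many boxes as there are parts greater than `j`, a count that does not depend
on where the new part is placed. -/
theorem colLen_insertRow (lam : YoungDiagram) (n j : ℕ) :
    (lam.insertRow n).colLen j = lam.colLen j + if j < n then 1 else 0 := by
  have h : lam.colLen j = lam.rowLens.countP (j < ·) := by
    rw [← colLen_ofRowLens lam.rowLens_sorted, ofRowLens_to_rowLens_eq_self]
  rw [insertRow, colLen_ofRowLens, (List.perm_orderedInsert _ n lam.rowLens).countP_eq,
    List.countP_cons, h]
  simp

theorem transpose_insertRow (lam : YoungDiagram) (n : ℕ) :
    (lam.insertRow n).transpose = lam.transpose.addColumn n :=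
  ext_rowLen fun j => by
    rw [rowLen_transpose, rowLen_addColumn, rowLen_transpose, colLen_insertRow]

theorem lrCoeff_le_insertRow (lam μ ν : YoungDiagram) {a b : ℕ} (hab : b ≤ a) :
    lrCoeff lam μ ν ≤ lrCoeff (lam.insertRow a) (μ.insertRow b) (ν.insertRow (a - b)) := by
  rw [← lrCoeff_transpose lam, ← lrCoeff_transpose (lam.insertRow a), transpose_insertRow,
    transpose_insertRow, transpose_insertRow]
  exact lrCoeff_le_addColumn _ _ _ hab

end YoungDiagram

theorem theorem3p1 (lam μ ν : YoungDiagram) (a b : ℕ) (hab : b ≤ a) :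
    YoungDiagram.lrCoeff lam μ ν ≤
      YoungDiagram.lrCoeff (lam.addColumn a) (μ.addColumn b) (ν.addColumn (a - b)) ∧
    YoungDiagram.lrCoeff lam μ ν ≤
      YoungDiagram.lrCoeff (lam.insertRow a) (μ.insertRow b) (ν.insertRow (a - b)) :=
  ⟨YoungDiagram.lrCoeff_le_addColumn lam μ ν hab, YoungDiagram.lrCoeff_le_insertRow lam μ ν hab⟩
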